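/- \textbf{Conventions.} Let $\Lambda$ be a group and $k$ a field. For finite $\Sigma,\Phi\subset\Lambda$ put $\partial_\Sigma\Phi:=\Sigma\Phi\setminus\Phi$. A F\o lner sequence in $\Lambda$ is a sequence of non-empty finite sets $\Phi_i\subset\Lambda$ with $|\partial_\Sigma\Phi_i|/|\Phi_i|\to 0$ for every finite $\Sigma\subset\Lambda$; $\Lambda$ is amenable if it has one. A matrix $T\in\mathrm{Mat}(a\times b,k[\Lambda])$ acts by left multiplication $k[\Lambda]^b\to k[\Lambda]^a$; let $T_\Phi:k[\Phi]^b\to k[\Phi]^a$ be its compression (restrict $T$ to $k[\Phi]^b$, then project along $k[\Lambda\setminus\Phi]^a$). If $\Lambda$ is amenable, the kernel gradient is $\dim_{k[\Lambda]}\ker T:=\lim_{i\to\infty}\dim_k\ker T_{\Phi_i}/|\Phi_i|$, where $(\Phi_i)$ is a F\o lner sequence; the limit is to exist and to be the same for all F\o lner sequences. Let $A$ be a countable discrete group isomorphic to a direct sum of copies of $\mathbb Z/2$, let $X$ be its Pontryagin dual and $\mu$ the Haar probability measure on $X$. For $p=\sum_a p_a a\in\mathbb Z[1/2][A]$ let $\widehat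 p(x)=\sum_a p_a\,x(a)$ for $x\in X$ (note $x(a)\in\{1,-1\}$). Call $p$ a projection if $\widehat p$ takes values in $\{0,1\}$, and call $p,r$ orthogonal if $\operatorname{supp}\widehat p\cap\operatorname{supp}\widehat r=\emptyset$. Let a group $\Gamma$ act on $A$ by automorphisms, hence on $\mathbb Z[1/2][A]$, written $\gamma.p$. If $\operatorname{char} k\ne2$, let $\rho$ denote the natural map $\mathbb Z[1/2]\to k$ and the induced map $\mathbb Z[1/2][\Gamma\ltimes A]\to k[\Gamma\ltimes A]$. Let $T\in\mathbb Z[1/2][\Gamma\ltimes A]$ be given with a fixed decomposition $T=\sum_{i=1}^m\gamma_if_i$, $\gamma_i\in\Gamma$, $f_i\in\mathbb Z[1/2][A]$. A $T$-graph (with respect to this decomposition) is a finite set $G\subset\mathbb Z[1/2][A]$ of pairwise orthogonal non-zero projections such that for all $p\in G$ and all $i$, either $\operatorname{supp}\widehat p\cap\operatorname{supp}\widehat f_i=\emptyset$, or $\operatorname{supp}\widehat p\subset\operatorname{supp}\widehat f_i$, in which case moreover $\gamma_i.p\in G$ and $\widehat f_i$ is constant on $\operatorname{supp}\widehat p$.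 The directed multigraph $\mathcal R(G,T)$ has vertex set $G$ and an edge from $p$ to $\gamma_i.p$ labeled $\gamma_i$ whenever $\operatorname{supp}\widehat p\subset\operatorname{supp}\widehat f_i$. Let $M(G,T;k):k[G]\to k[G]$ be the linear map $p\mapsto\sum_{q\in G}\Big(\sum_{i:\ \gamma_i.p=q}\rho(\langle f_i,p\rangle)\Big)q$, where $\langle f_i,p\rangle$ is the constant value of $\widehat f_i$ on $\operatorname{supp}\widehat p$. A $(T_1,\dots,T_l)$-graph is a set $G$ that is a $T_j$-graph for every $j$. It is simply-connected if in the union of the multigraphs $\mathcal R(G,T_1),\dots,\mathcal R(G,T_l)$ any two vertices are joined by a path, and every closed path has label $e$; here edges of a path may be traversed in either direction, the empty path is allowed, and the label of a path is the product $\lambda_w\cdots\lambda_1$ of the labels of its successive edges, inverted for edges traversed backwards. Put $\operatorname{supp}G:=\bigcup_{p\in G}\operatorname{supp}\widehat p$. A sequence $G_1,G_2,\dots$ of $(T_1,\dots,T_l)$-graphs is exhausting if for $i\ne j$ every element of $G_i$ is orthogonal to every element of $G_j$, and $\sum_{i=1}^\infty\mu(\operatorname{supp}G_i)=1$. \textbf{Theorem.}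 Let $k$ be a field with $\operatorname{char}k\ne2$, let $\Gamma$ be a countable amenable group, let $A$ be a countable group isomorphic to a direct sum of copies of $\mathbb Z/2$, and let $\Gamma$ act on $A$ by group automorphisms. Let $T_1,\dots,T_l\in\mathbb Z[1/2][\Gamma\ltimes A]$ (with fixed decompositions as above), and let $G_1,G_2,\dots$ be an exhausting sequence of simply-connected $(T_1,\dots,T_l)$-graphs. Then $\Gamma\ltimes A$ is amenable, the kernel gradient below is well defined, the series converges, and $$\dim_{k[\Gamma\ltimes A]}\ker\begin{bmatrix}\rho(T_1)\\ \vdots\\ \rho(T_l)\end{bmatrix}=\sum_{i=1}^\infty\frac{\mu(\operatorname{supp}G_i)}{|G_i|}\,\dim_k\ker\begin{bmatrix}M(G_i,T_1;k)\\ \vdots\\ M(G_i,T_l;k)\end{bmatrix},$$ where terms with $G_i=\emptyset$ are read as $0$. -/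

import Mathlib

open scoped Pointwise
open Filter Topology MeasureTheory

/-! ### Følner sequences and kernel gradients -/

section KernelGradient

open Classical in
/-- The boundary `∂_S Φ = S · Φ \ Φ` of a finite subset `Φ` of a group. -/
noncomputable def folnerBoundary {Λ : Type*} [Group Λ] (S Φ : Finset Λ) : Finset Λ :=
  (S * Φ) \ Φ

/-- A Følner sequence in a group: non-empty finite sets `Φ i` such that `|∂_S Φ i| / |Φ i|` tends
to `0` for every finite set `S`. -/
def IsFolnerSeq {Λ : Type*} [Group Λ] (Φ : ℕ → Finset Λ) : Prop :=
  (∀ i, (Φ i).Nonempty) ∧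
    ∀ S : Finset Λ,
      Tendsto (fun i => ((folnerBoundary S (Φ i)).card : ℝ) / ((Φ i).card : ℝ)) atTop (𝓝 0)

/-- A group is amenable if it has a Følner sequence. -/
def IsAmenableGroup (Λ : Type*) [Group Λ] : Prop :=
  ∃ Φ : ℕ → Finset Λ, IsFolnerSeq Φ

variable {k : Type*} [Field k] {Λ : Type*} [Group Λ]

/-- The inclusion `k[Φ] → k[Λ]`. -/
noncomputable def finInclusion (k : Type*) [Field k] {Λ : Type*} [Group Λ] (Φ : Finset Λ) :
    (Φ →₀ k) →ₗ[k] MonoidAlgebra k Λ :=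
  (MonoidAlgebra.coeffLinearEquiv k).symm.toLinearMap ∘ₗ
    Finsupp.lmapDomain k k (Subtype.val : Φ → Λ)

/-- The projection `π_Φ : k[Λ] → k[Φ]` along `k[Λ \ Φ]`. -/
noncomputable def finProjection (k : Type*) [Field k] {Λ : Type*} [Group Λ] (Φ : Finset Λ) :
    MonoidAlgebra k Λ →ₗ[k] (Φ →₀ k) :=
  Finsupp.lsubtypeDomain (Φ : Set Λ) ∘ₗ (MonoidAlgebra.coeffLinearEquiv k).toLinearMap

/-- A matrix over `k[Λ]` as a `k`-linear operator on columns, by left multiplication. -/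
noncomputable def matrixOperator {a b : ℕ} (T : Matrix (Fin a) (Fin b) (MonoidAlgebra k Λ)) :
    (Fin b → MonoidAlgebra k Λ) →ₗ[k] (Fin a → MonoidAlgebra k Λ) :=
  LinearMap.pi fun i => ∑ j, LinearMap.mulLeft k (T i j) ∘ₗ LinearMap.proj j

/-- The compression `T_Φ = π_Φ ∘ T : k[Φ]^b → k[Φ]^a`. -/
noncomputable def compression {a b : ℕ} (T : Matrix (Fin a) (Fin b) (MonoidAlgebra k Λ))
    (Φ : Finset Λ) : (Fin b → (Φ →₀ k)) →ₗ[k] (Fin a → (Φ →₀ k)) :=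
  (finProjection k Φ).compLeft (Fin a) ∘ₗ matrixOperator T ∘ₗ (finInclusion k Φ).compLeft (Fin b)

/-- `HasKernelGradient T d`: the group `Λ` is amenable, and the kernel gradient
`dim_{k[Λ]} ker T` is well defined and equal to `d`, i.e. `dim_k ker T_{Φ i} / |Φ i|` tends to `d`
for every Følner sequence `Φ`. -/
def HasKernelGradient {a b : ℕ} (T : Matrix (Fin a) (Fin b) (MonoidAlgebra k Λ)) (d : ℝ) : Prop :=
  IsAmenableGroup Λ ∧
    ∀ Φ : ℕ → Finset Λ, IsFolnerSeq Φ →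
      Tendsto
        (fun i => (Module.finrank k (LinearMap.ker (compression T (Φ i))) : ℝ) / ((Φ i).card : ℝ))
        atTop (𝓝 d)

end KernelGradient

/-! ### The ring `ℤ[1/2]` -/

/-- The ring `ℤ[1/2]`. -/
abbrev ZHalf : Type := Localization.Away (2 : ℤ)

/-- The natural homomorphism `ℤ[1/2] → k` for a field of characteristic different from `2`. -/
noncomputable def zhalfReduction (k : Type*) [Field k] (hk : ringChar k ≠ 2) : ZHalf →+* k :=
  IsLocalization.Away.lift (2 : ℤ) (g := Int.castRingHom k)
    (by simpa using (Ring.two_ne_zero hk).isUnit)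

/-! ### Pontryagin duality

Below `A` is a discrete group isomorphic to a direct sum of copies of `ℤ/2`, so that every
character of `A` takes only the values `1` and `-1`. -/

section Duality

variable {A : Type*} [CommGroup A] [TopologicalSpace A]

open Classical in
/-- The value `x a ∈ {1, -1}` of a character of an elementary abelian `2`-group, as an element
of `ℤ[1/2]`. -/
noncomputable def charValue (x : PontryaginDual A) (a : A) : ZHalf :=
  if x a = 1 then 1 else -1

/-- The function `p̂ : X → ℤ[1/2]` on the dual group corresponding to `p ∈ ℤ[1/2][A]`. -/
noncomputable def hatFun (p : MonoidAlgebra ZHalf A) (x : PontryaginDual A) : ZHalf :=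
  p.coeff.sum fun a r => r * charValue x a

/-- `supp p̂`. -/
def hatSupp (p : MonoidAlgebra ZHalf A) : Set (PontryaginDual A) :=
  Function.support (hatFun p)

/-- `p` is a projection if `p̂` takes values in `{0, 1}`. -/
def IsProjection (p : MonoidAlgebra ZHalf A) : Prop :=
  ∀ x, hatFun p x = 0 ∨ hatFun p x = 1

/-- `p ⟂ r`: the supports of `p̂` and `r̂` are disjoint. -/
def IsOrth (p r : MonoidAlgebra ZHalf A) : Prop :=
  Disjoint (hatSupp p) (hatSupp r)

open Classical in
/-- `⟨f, p⟩`: the value of `f̂` on `supp p̂`, meant for `f̂` constant on `supp p̂ ≠ ∅`. -/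
noncomputable def pairing (f p : MonoidAlgebra ZHalf A) : ZHalf :=
  if h : (hatSupp p).Nonempty then hatFun f h.choose else 0

end Duality

/-! ### `T`-graphs -/

section Graphs

variable {Γ : Type*} [Group Γ] {A : Type*} [CommGroup A] (φ : Γ →* MulAut A)

/-- The action `γ . p` of `Γ` on `ℤ[1/2][A]`. -/
noncomputable def actOn (γ : Γ) (p : MonoidAlgebra ZHalf A) : MonoidAlgebra ZHalf A :=
  MonoidAlgebra.mapDomain (φ γ) p

/-- A decomposition `T = ∑ i, γ i * f i` of an element of `ℤ[1/2][Γ ⋉ A]`, with `γ i ∈ Γ` and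
`f i ∈ ℤ[1/2][A]`. -/
structure Decomposition (T : MonoidAlgebra ZHalf (A ⋊[φ] Γ)) where
  m : ℕ
  γ : Fin m → Γ
  f : Fin m → MonoidAlgebra ZHalf A
  eq_sum : T = ∑ i, MonoidAlgebra.single (SemidirectProduct.inr (γ i)) 1 *
    MonoidAlgebra.mapDomain SemidirectProduct.inl (f i)

variable [TopologicalSpace A] {φ}

/-- `T`-graphs, with respect to a decomposition of `T`. -/
structure IsTGraph {T : MonoidAlgebra ZHalf (A ⋊[φ] Γ)} (D : Decomposition φ T)
    (G : Finset (MonoidAlgebra ZHalf A)) : Prop where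
  projection : ∀ p ∈ G, IsProjection p ∧ p ≠ 0
  orth : ∀ p ∈ G, ∀ q ∈ G, p ≠ q → IsOrth p q
  dichotomy : ∀ p ∈ G, ∀ i, hatSupp p ⊆ hatSupp (D.f i) ∨ Disjoint (hatSupp p) (hatSupp (D.f i))
  act_mem : ∀ p ∈ G, ∀ i, hatSupp p ⊆ hatSupp (D.f i) → actOn φ (D.γ i) p ∈ G
  constant : ∀ p ∈ G, ∀ i, hatSupp p ⊆ hatSupp (D.f i) →
    ∀ x ∈ hatSupp p, ∀ y ∈ hatSupp p, hatFun (D.f i) x = hatFun (D.f i) y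

/-- The edge relation of the labeled directed multigraph `R(G, T)`: there is an edge from `p` to
`γ . p` with label `γ`. -/
def IsEdge {T : MonoidAlgebra ZHalf (A ⋊[φ] Γ)} (D : Decomposition φ T)
    (G : Finset (MonoidAlgebra ZHalf A)) (p : MonoidAlgebra ZHalf A) (γ : Γ) : Prop :=
  p ∈ G ∧ ∃ i, γ = D.γ i ∧ hatSupp p ⊆ hatSupp (D.f i)

section Family

variable {l : ℕ} {T : Fin l → MonoidAlgebra ZHalf (A ⋊[φ] Γ)} (D : ∀ j, Decomposition φ (T j))
  (G : Finset (MonoidAlgebra ZHalf A))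

/-- The union over `j` of the multigraphs `R(G, T j)`. -/
def IsFamilyEdge (p : MonoidAlgebra ZHalf A) (γ : Γ) : Prop :=
  ∃ j, IsEdge (D j) G p γ

/-- `HasPath D G p q γ`: there is a path from `p` to `q` with label `γ`, where edges may be
traversed in both directions, contributing the inverse label when traversed backwards. -/
inductive HasPath : MonoidAlgebra ZHalf A → MonoidAlgebra ZHalf A → Γ → Prop
  | nil {p : MonoidAlgebra ZHalf A} (hp : p ∈ G) : HasPath p p 1
  | cons {p q : MonoidAlgebra ZHalf A} {γ : Γ} (c : Γ) (h : HasPath p q γ)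
      (hc : IsFamilyEdge D G q c ∨ IsFamilyEdge D G (actOn φ c q) c⁻¹) :
      HasPath p (actOn φ c q) (c * γ)

/-- Simply-connected `(T_1, …, T_l)`-graphs. -/
structure IsSimplyConnectedGraph : Prop where
  isTGraph : ∀ j, IsTGraph (D j) G
  connected : ∀ p ∈ G, ∀ q ∈ G, ∃ γ, HasPath D G p q γ
  label_loop : ∀ p ∈ G, ∀ γ, HasPath D G p p γ → γ = 1

end Family

/-- `supp G`, the union of the supports of the elements of `G`. -/
def graphSupp (G : Finset (MonoidAlgebra ZHalf A)) : Set (PontryaginDual A) :=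
  ⋃ p ∈ G, hatSupp p

/-- A sequence of pairwise orthogonal graphs whose supports have total measure `1`. -/
def IsExhausting [MeasurableSpace (PontryaginDual A)] (μ : Measure (PontryaginDual A))
    (G : ℕ → Finset (MonoidAlgebra ZHalf A)) : Prop :=
  (∀ i j, i ≠ j → ∀ p ∈ G i, ∀ q ∈ G j, IsOrth p q) ∧ ∑' i, μ (graphSupp (G i)) = 1

variable (k : Type*) [Field k] (hk : ringChar k ≠ 2)

open Classical in
/-- The coefficient `M(p, q; k)`. -/
noncomputable def adjCoeff {T : MonoidAlgebra ZHalf (A ⋊[φ] Γ)} (D : Decomposition φ T)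
    (p q : MonoidAlgebra ZHalf A) : k :=
  ∑ i with actOn φ (D.γ i) p = q, zhalfReduction k hk (pairing (D.f i) p)

/-- The adjacency operator `M(G, T; k) : k[G] → k[G]`, `p ↦ ∑ q, M(p, q; k) q`. -/
noncomputable def adjOperator {T : MonoidAlgebra ZHalf (A ⋊[φ] Γ)} (D : Decomposition φ T)
    (G : Finset (MonoidAlgebra ZHalf A)) : (G →₀ k) →ₗ[k] (G →₀ k) :=
  Finsupp.linearCombination k fun p : G => ∑ q : G, Finsupp.single q (adjCoeff k hk D p.1 q.1)

/-- The stacked adjacency operators `k[G] → k[G]^l`. -/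
noncomputable def stackedAdjOperator {l : ℕ} {T : Fin l → MonoidAlgebra ZHalf (A ⋊[φ] Γ)}
    (D : ∀ j, Decomposition φ (T j)) (G : Finset (MonoidAlgebra ZHalf A)) :
    (G →₀ k) →ₗ[k] (Fin l → (G →₀ k)) :=
  LinearMap.pi fun j => adjOperator k hk (D j) G

end Graphs

/-- The stacked column of the reductions `ρ(T_1), …, ρ(T_l)`. -/
noncomputable def stackedReduction (k : Type*) [Field k] (hk : ringChar k ≠ 2) {Λ : Type*} [Group Λ]
    {l : ℕ} (T : Fin l → MonoidAlgebra ZHalf Λ) : Matrix (Fin l) (Fin 1) (MonoidAlgebra k Λ) :=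
  Matrix.of fun j _ => MonoidAlgebra.mapRingHom Λ (zhalfReduction k hk) (T j)

/-! The proof exhibits, inside each compression, explicit direct sums of copies of the finite
operators `M(G_i, T_j; k)` that fill up almost the whole space. Write Λ for Γ ⋉ A.

Simple connectivity supplies a base projection p₀ and a well-defined label γ_p for each vertex p of
G, with γ_p.p₀ = p and labels multiplying along edges (`GraphLabeling`). In particular all vertices
have supports of the same measure, so μ(supp G)/|G| is the measure of supp p₀, which is the
coefficient of p₀ at 1 (`measureReal_graphSupp`).

Choose a finite subgroup C of A (a cube) supporting the bases of finitely many graphs. Its character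
idempotents E_w split each p₀ into those E_w with p₀E_w = E_w, and there are |C|·μ(supp p₀) of them
(`card_hatFun_eq_one`). For such w and for x in Λ the vectors γ_p E_w x, with p in G, satisfy p γ_p
E_w x = γ_p E_w x. On supp p each f_i is constant, and γ_i γ_p is the label of the next vertex;
hence T_j acts on these vectors exactly as M(G, T_j; k) (`mul_vertexVec`,
`reductionHom_mul_vertexVec`).

Given a finite set Φ in Λ, let x run over representatives of the cosets Cx that meet a suitable
interior of Φ. The resulting vectors are supported in Φ and are linearly independent
(`linearIndependent_blockVec`); here 2 has to be invertible in k. There are J_i ≥ μ(supp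
p₀)·|interior| blocks for G_i. The kernels of the blocks bound dim ker T_Φ from below, and their
ranks bound rank T_Φ from below, hence dim ker T_Φ from above
(`finrank_ker_bounds_of_intertwining`).

Divide by |Φ| and go along a Følner sequence with the first N graphs fixed. The two bounds then
differ by 1 − ∑_{i<N} μ(supp G_i), which tends to 0 because the graphs are exhausting
(`tendsto_of_forall_bounds`). No property of the Følner sequence beyond its definition is used, so
the limit does not depend on it. -/

/-! ### Arithmetic of `ℤ[1/2]` -/

/-- The element `1/2` of `ℤ[1/2]`. -/
noncomputable def zhalfHalf : ZHalf := IsLocalization.Away.invSelf (2 : ℤ)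

lemma two_mul_zhalfHalf : (2 : ZHalf) * zhalfHalf = 1 := by
  have := IsLocalization.Away.mul_invSelf (S := ZHalf) (2 : ℤ)
  simpa [zhalfHalf] using this

/-- The inclusion `ℤ[1/2] → ℝ`. -/
noncomputable def zhalfReal : ZHalf →+* ℝ :=
  IsLocalization.Away.lift (2 : ℤ) (g := Int.castRingHom ℝ) (by simp)

instance : Nontrivial ZHalf := zhalfReal.domain_nontrivial

lemma zhalf_eq_zero_of_eq_neg {R : Type*} [CommRing R] (f : ZHalf →+* R) {x : R} (h : x = -x) :
    x = 0 := by
  have h1 : x = f (2 * zhalfHalf) * x := by rw [two_mul_zhalfHalf]; simp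
  have h2 : x + x = 0 := by nth_rewrite 2 [h]; simp
  rw [h1, map_mul, map_ofNat]
  linear_combination f zhalfHalf * h2

/-- The sign character `ℤ/2 → {1, -1}`. -/
noncomputable def zsign (z : ZMod 2) : ZHalf := if z = 0 then 1 else -1

lemma zsign_zero : zsign 0 = 1 := by simp [zsign]

lemma zsign_add (z w : ZMod 2) : zsign (z + w) = zsign z * zsign w := by
  have h : (1 : ZMod 2) + 1 = 0 := by decide
  have h01 : ∀ z : ZMod 2, z = 0 ∨ z = 1 := by decide
  have hn : (-1 : ZHalf) * -1 = 1 := by ring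
  rcases h01 z with rfl | rfl <;> rcases h01 w with rfl | rfl <;> simp [zsign, h, hn]

/-- Translating u by a basis vector on which v is nonzero flips every sign, so the sum equals its
own negative. -/
lemma sum_zsign_dotProduct {s : Type*} [Fintype s] [DecidableEq s] (v : s → ZMod 2) (hv : v ≠ 0) :
    ∑ u : s → ZMod 2, zsign (u ⬝ᵥ v) = 0 := by
  obtain ⟨i, hi⟩ := Function.ne_iff.1 hv
  have h1 : v i = 1 := by
    have : ∀ z : ZMod 2, z ≠ 0 → z = 1 := by decide
    exact this _ hi
  apply zhalf_eq_zero_of_eq_neg (RingHom.id ZHalf)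
  rw [← Finset.sum_neg_distrib]
  refine Fintype.sum_equiv (Equiv.addRight (Pi.single i 1)) _ _ fun u => ?_
  rw [Equiv.coe_addRight, add_dotProduct, zsign_add, single_one_dotProduct, h1]
  have hn : (-1 : ZHalf) * -1 = 1 := by ring
  by_cases h0 : u ⬝ᵥ v = 0 <;> simp [zsign, h0, hn]

lemma sum_zsign_dotProduct_eq_ite {s : Type*} [Fintype s] [DecidableEq s] (v : s → ZMod 2) :
    ∑ u : s → ZMod 2, zsign (u ⬝ᵥ v) = if v = 0 then 2 ^ Fintype.card s else 0 := by
  split_ifs with h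
  · simp [h, zsign_zero, ZMod.card]
  · exact sum_zsign_dotProduct v h

/-! ### The Fourier transform -/

section Fourier

variable {A : Type*} [CommGroup A] [TopologicalSpace A]

lemma coe_char_eq (h2 : ∀ a : A, a * a = 1) (x : PontryaginDual A) (a : A) :
    x a = 1 ∨ ((x a : Circle) : ℂ) = -1 := by
  have h : x a * x a = 1 := by rw [← map_mul, h2, map_one]
  have h' : ((x a : Circle) : ℂ) * (x a : Circle) = 1 := by rw [← Circle.coe_mul, h, Circle.coe_one]
  rcases mul_self_eq_one_iff.1 h' with h | h
  · left; exact Circle.ext (by simpa using h)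
  · right; exact h

lemma charValue_one (x : PontryaginDual A) : charValue x 1 = 1 := by simp [charValue]

lemma charValue_mul (h2 : ∀ a : A, a * a = 1) (x : PontryaginDual A) (a b : A) :
    charValue x (a * b) = charValue x a * charValue x b := by
  have hm : x (a * b) = x a * x b := map_mul x a b
  rcases coe_char_eq h2 x a with ha | ha
  · have h : x (a * b) = x b := by rw [hm, ha, one_mul]
    by_cases hb : x b = 1 <;> simp [charValue, ha, h, hb]
  rcases coe_char_eq h2 x b with hb | hb
  · have h : x (a * b) = x a := by rw [hm, hb, mul_one]
    by_cases ha : x a = 1 <;> simp [charValue, ha, h, hb]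
  have ha1 : x a ≠ 1 := by intro h; rw [h] at ha; norm_num at ha
  have hb1 : x b ≠ 1 := by intro h; rw [h] at hb; norm_num at hb
  have hab : x a * x b = 1 := Circle.ext (by simp [ha, hb])
  have hn : (-1 : ZHalf) * -1 = 1 := by ring
  simp [charValue, ha1, hb1, hab, hm, hn]

lemma zhalfReal_charValue (h2 : ∀ a : A, a * a = 1) (x : PontryaginDual A) (a : A) :
    zhalfReal (charValue x a) = ((x a : Circle) : ℂ).re := by
  rcases coe_char_eq h2 x a with ha | ha
  · simp [charValue, ha]
  · have ha1 : x a ≠ 1 := by intro h; rw [h] at ha; norm_num at ha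
    simp [charValue, ha1, ha]

/-- Evaluation of the Fourier transform at a character, as a ring homomorphism. -/
noncomputable def hatHom (h2 : ∀ a : A, a * a = 1) (x : PontryaginDual A) :
    MonoidAlgebra ZHalf A →ₐ[ZHalf] ZHalf :=
  MonoidAlgebra.lift ZHalf ZHalf A
    { toFun := charValue x, map_one' := charValue_one x, map_mul' := charValue_mul h2 x }

lemma hatHom_apply (h2 : ∀ a : A, a * a = 1) (x : PontryaginDual A) (p : MonoidAlgebra ZHalf A) :
    hatHom h2 x p = hatFun p x := by
  simp [hatHom, hatFun, MonoidAlgebra.lift_apply]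

end Fourier

/-! ### Cubes in an elementary abelian `2`-group -/

section Cube

variable {A : Type*} [CommGroup A] {ι : Type*} [DecidableEq ι] (e : Additive A ≃+ (ι →₀ ZMod 2)) (s : Finset ι)

/-- The coordinates of an element of `A` in a finite set of directions. -/
noncomputable def cubeCoords (a : A) : s → ZMod 2 := fun i => e (Additive.ofMul a) i

/-- The element of `A` with given coordinates in a finite set of directions, the other coordinates
being zero. -/
noncomputable def cubePoint (u : s → ZMod 2) : A :=
  Additive.toMul (e.symm (∑ i : s, Finsupp.single (i : ι) (u i)))

omit [DecidableEq ι] in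
lemma cubeCoords_mul (a b : A) : cubeCoords e s (a * b) = cubeCoords e s a + cubeCoords e s b := by
  ext i
  simp [cubeCoords]

omit [DecidableEq ι] in
lemma cubePoint_add (u v : s → ZMod 2) :
    cubePoint e s (u + v) = cubePoint e s u * cubePoint e s v := by
  simp [cubePoint, Finset.sum_add_distrib]

omit [DecidableEq ι] in
lemma cubePoint_zero : cubePoint e s 0 = 1 := by simp [cubePoint]

lemma cubeCoords_cubePoint (u : s → ZMod 2) : cubeCoords e s (cubePoint e s u) = u := by
  classical
  ext i
  simp [cubeCoords, cubePoint, Finsupp.finsetSum_apply, Finsupp.single_apply]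

omit [DecidableEq ι] in
lemma cubePoint_cubeCoords {a : A} (ha : (e (Additive.ofMul a)).support ⊆ s) :
    cubePoint e s (cubeCoords e s a) = a := by
  classical
  have h : ∑ i : s, Finsupp.single (i : ι) (cubeCoords e s a i) = e (Additive.ofMul a) := by
    conv_rhs => rw [← Finsupp.sum_single (e (Additive.ofMul a))]
    rw [Finsupp.sum_of_support_subset _ ha _ (by simp), ← Finset.sum_coe_sort s]
    rfl
  rw [cubePoint, h, AddEquiv.symm_apply_apply, toMul_ofMul]

lemma cubePoint_injective : Function.Injective (cubePoint e s) :=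
  Function.LeftInverse.injective (cubeCoords_cubePoint e s)

/-- The finite subgroup of elements supported in a finite set of directions. -/
noncomputable def cube : Finset A :=
  Finset.univ.map ⟨cubePoint e s, cubePoint_injective e s⟩

lemma mem_cube {a : A} : a ∈ cube e s ↔ ∃ u, cubePoint e s u = a := by simp [cube]

lemma card_cube : (cube e s).card = Fintype.card (s → ZMod 2) := by simp [cube]

lemma one_mem_cube : (1 : A) ∈ cube e s := (mem_cube e s).2 ⟨0, cubePoint_zero e s⟩

lemma mul_mem_cube {a b : A} (ha : a ∈ cube e s) (hb : b ∈ cube e s) : a * b ∈ cube e s := by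
  obtain ⟨u, rfl⟩ := (mem_cube e s).1 ha
  obtain ⟨v, rfl⟩ := (mem_cube e s).1 hb
  exact (mem_cube e s).2 ⟨u + v, cubePoint_add e s u v⟩

omit [DecidableEq ι] in
include e in
lemma mul_self_eq_one (a : A) : a * a = 1 := by
  have h : Additive.ofMul a + Additive.ofMul a = 0 := by
    apply e.injective
    ext i
    simpa using CharTwo.add_self_eq_zero (e (Additive.ofMul a) i)
  exact h

lemma exists_subset_cube (P : Finset A) : ∃ s : Finset ι, P ⊆ cube e s := by
  classical
  refine ⟨P.biUnion fun a => (e (Additive.ofMul a)).support, fun a ha => ?_⟩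
  exact (mem_cube e _).2 ⟨_, cubePoint_cubeCoords e _
    (Finset.subset_biUnion_of_mem (fun a => (e (Additive.ofMul a)).support) ha)⟩

/-- The idempotents of `ℤ[1/2][A]` attached to the characters of a cube. -/
noncomputable def cubeIdem (w : s → ZMod 2) : MonoidAlgebra ZHalf A :=
  ∑ u : s → ZMod 2, MonoidAlgebra.single (cubePoint e s u) (zhalfHalf ^ s.card * zsign (w ⬝ᵥ u))

lemma coeff_cubeIdem_eq_zero {w : s → ZMod 2} {a : A} (ha : a ∉ cube e s) :
    (cubeIdem e s w).coeff a = 0 := by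
  rw [mem_cube] at ha
  push Not at ha
  simp [cubeIdem, Finsupp.finsetSum_apply, ha]

lemma support_cubeIdem_subset (w : s → ZMod 2) : (cubeIdem e s w).coeff.support ⊆ cube e s := by
  intro a ha
  by_contra h
  exact (Finsupp.mem_support_iff.1 ha) (coeff_cubeIdem_eq_zero e s h)

lemma coeff_cubeIdem_one (w : s → ZMod 2) :
    (cubeIdem e s w).coeff 1 = zhalfHalf ^ s.card := by
  classical
  have h : ∀ u, cubePoint e s u = 1 ↔ u = 0 := fun u => by
    rw [← cubePoint_zero e s, (cubePoint_injective e s).eq_iff]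
  simp [cubeIdem, Finsupp.finsetSum_apply, Finsupp.single_apply, h, zsign_zero]

lemma zhalfHalf_pow_mul (n : ℕ) : zhalfHalf ^ n * 2 ^ n = 1 := by
  rw [← mul_pow, mul_comm, two_mul_zhalfHalf, one_pow]

lemma sum_cubeIdem : ∑ w, cubeIdem e s w = 1 := by
  classical
  simp only [cubeIdem]
  rw [Finset.sum_comm]
  have h : ∀ u : s → ZMod 2, ∑ w : s → ZMod 2, MonoidAlgebra.single (cubePoint e s u)
      (zhalfHalf ^ s.card * zsign (w ⬝ᵥ u)) =
      if u = 0 then (1 : MonoidAlgebra ZHalf A) else 0 := by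
    intro u
    have h1 : ∑ w : s → ZMod 2, MonoidAlgebra.single (cubePoint e s u)
        (zhalfHalf ^ s.card * zsign (w ⬝ᵥ u)) = MonoidAlgebra.single (cubePoint e s u)
        (∑ w : s → ZMod 2, zhalfHalf ^ s.card * zsign (w ⬝ᵥ u)) :=
      (map_sum (MonoidAlgebra.singleAddHom (cubePoint e s u)) _ _).symm
    rw [h1, ← Finset.mul_sum, sum_zsign_dotProduct_eq_ite]
    split_ifs with hu
    · rw [hu, cubePoint_zero, Fintype.card_coe, zhalfHalf_pow_mul]; rfl
    · simp
  simp [h]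

/-- Multiplication by a group element only shifts the summation index, so the idempotent is an
eigenvector whose eigenvalue is the character value. -/
lemma single_cubePoint_mul_cubeIdem (v w : s → ZMod 2) :
    MonoidAlgebra.single (cubePoint e s v) (1 : ZHalf) * cubeIdem e s w =
      zsign (w ⬝ᵥ v) • cubeIdem e s w := by
  have hz : ∀ z : ZMod 2, z + z = 0 := CharTwo.add_self_eq_zero
  rw [cubeIdem, Finset.mul_sum, Finset.smul_sum]
  refine Fintype.sum_equiv (Equiv.addLeft v) _ _ fun u => ?_
  rw [Equiv.coe_addLeft, dotProduct_add, zsign_add, cubePoint_add,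
    MonoidAlgebra.single_mul_single, MonoidAlgebra.smul_single, smul_eq_mul, one_mul]
  congr 1
  have : zsign (w ⬝ᵥ v) * zsign (w ⬝ᵥ v) = 1 := by rw [← zsign_add, hz, zsign_zero]
  linear_combination (-zhalfHalf ^ s.card * zsign (w ⬝ᵥ u)) * this

variable [TopologicalSpace A] [DiscreteTopology A]

/-- The characters of `A` depending on finitely many coordinates only. -/
noncomputable def cubeChar (w : s → ZMod 2) : PontryaginDual A :=
  ContinuousMonoidHom.mk (MonoidHom.mk' (fun a => ZMod.toCircle (w ⬝ᵥ cubeCoords e s a))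
    fun a b => by rw [cubeCoords_mul, dotProduct_add, AddChar.map_add_eq_mul])
    continuous_of_discreteTopology

omit [DecidableEq ι] in
lemma cubeChar_apply (w : s → ZMod 2) (a : A) :
    cubeChar e s w a = ZMod.toCircle (w ⬝ᵥ cubeCoords e s a) := rfl

omit [DecidableEq ι] in
lemma charValue_cubeChar (w : s → ZMod 2) (a : A) :
    charValue (cubeChar e s w) a = zsign (w ⬝ᵥ cubeCoords e s a) := by
  have h : ∀ z : ZMod 2, ZMod.toCircle z = 1 ↔ z = 0 := fun z => by
    rw [← ZMod.injective_toCircle.eq_iff (b := 0), AddChar.map_zero_eq_one]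
  simp [charValue, zsign, cubeChar_apply, h]

lemma mul_cubeIdem {f : MonoidAlgebra ZHalf A} (hf : f.coeff.support ⊆ cube e s)
    (w : s → ZMod 2) : f * cubeIdem e s w = hatFun f (cubeChar e s w) • cubeIdem e s w := by
  conv_lhs => rw [← MonoidAlgebra.sum_coeff_single f]
  rw [Finsupp.sum, Finset.sum_mul, hatFun, Finsupp.sum, Finset.sum_smul]
  refine Finset.sum_congr rfl fun a ha => ?_
  obtain ⟨v, rfl⟩ := (mem_cube e s).1 (hf ha)
  have h := single_cubePoint_mul_cubeIdem e s v w
  rw [charValue_cubeChar, cubeCoords_cubePoint, mul_smul, ← h, ← smul_mul_assoc,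
    MonoidAlgebra.smul_single, smul_eq_mul, mul_one]

/-- Orthogonality of characters: the product of the characters of w and w' is that of w + w', whose
sum vanishes unless w = w'. -/
lemma hatFun_cubeIdem [DecidableEq (s → ZMod 2)] (w w' : s → ZMod 2) :
    hatFun (cubeIdem e s w) (cubeChar e s w') = if w = w' then 1 else 0 := by
  classical
  rw [← hatHom_apply (mul_self_eq_one e), cubeIdem, map_sum]
  have hs : ∀ (a : A) (r : ZHalf), hatHom (mul_self_eq_one e) (cubeChar e s w')
      (MonoidAlgebra.single a r) = r * charValue (cubeChar e s w') a := fun a r => by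
    rw [hatHom_apply]; simp [hatFun]
  simp only [hs, charValue_cubeChar, cubeCoords_cubePoint]
  have : ∀ u, zhalfHalf ^ s.card * zsign (w ⬝ᵥ u) * zsign (w' ⬝ᵥ u) =
      zhalfHalf ^ s.card * zsign (u ⬝ᵥ (w + w')) := fun u => by
    rw [mul_assoc, ← zsign_add, ← add_dotProduct, dotProduct_comm]
  simp only [this]
  rw [← Finset.mul_sum, sum_zsign_dotProduct_eq_ite]
  have h0 : w + w' = 0 ↔ w = w' := by
    simp only [funext_iff, Pi.add_apply, Pi.zero_apply, CharTwo.add_eq_zero]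
  simp only [h0, Fintype.card_coe]
  split_ifs
  · exact zhalfHalf_pow_mul _
  · simp

lemma cubeIdem_mul_cubeIdem [DecidableEq (s → ZMod 2)] (w w' : s → ZMod 2) :
    cubeIdem e s w * cubeIdem e s w' = if w = w' then cubeIdem e s w else 0 := by
  rw [mul_cubeIdem e s (support_cubeIdem_subset e s w), hatFun_cubeIdem]
  split_ifs with h
  · rw [h]; exact one_smul ZHalf (cubeIdem e s w')
  · exact zero_smul ZHalf (cubeIdem e s w')

lemma eq_sum_hatFun_smul_cubeIdem {f : MonoidAlgebra ZHalf A} (hf : f.coeff.support ⊆ cube e s) :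
    f = ∑ w, hatFun f (cubeChar e s w) • cubeIdem e s w := by
  simp only [← mul_cubeIdem e s hf]
  rw [← Finset.mul_sum, sum_cubeIdem, mul_one]

-- Fourier inversion: both elements lie in a common finite cube, where they are combinations of
-- idempotents with their transforms as coefficients.
include e in
lemma eq_of_hatFun_eq {f g : MonoidAlgebra ZHalf A} (h : ∀ x, hatFun f x = hatFun g x) :
    f = g := by
  classical
  obtain ⟨s, hs⟩ := exists_subset_cube e (f.coeff.support ∪ g.coeff.support)
  rw [eq_sum_hatFun_smul_cubeIdem e s (Finset.union_subset_left hs),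
    eq_sum_hatFun_smul_cubeIdem e s (Finset.union_subset_right hs)]
  simp only [h]

-- Compare coefficients at 1 in the expansion into idempotents: each idempotent below p contributes
-- 2^(-|s|). This counts the blocks later on.
open Classical in
lemma card_hatFun_eq_one {p : MonoidAlgebra ZHalf A} (hp : IsProjection p)
    (hs : p.coeff.support ⊆ cube e s) :
    ((Finset.univ.filter fun w => hatFun p (cubeChar e s w) = 1).card : ZHalf) =
      2 ^ s.card * p.coeff 1 := by
  have h := congrArg (fun f => f.coeff 1) (eq_sum_hatFun_smul_cubeIdem e s hs)
  simp only [MonoidAlgebra.coeff_sum, Finsupp.finsetSum_apply, MonoidAlgebra.coeff_smul,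
    Finsupp.smul_apply, coeff_cubeIdem_one, smul_eq_mul] at h
  rw [h, ← Finset.sum_mul, Finset.card_filter, mul_left_comm, mul_comm (2 ^ _),
    zhalfHalf_pow_mul, mul_one, Nat.cast_sum]
  refine Finset.sum_congr rfl fun w _ => ?_
  rcases hp (cubeChar e s w) with h0 | h0 <;> simp [h0]

end Cube

/-! ### Haar measure of the support of a projection -/

section Haar

variable {A : Type*} [CommGroup A] [TopologicalSpace A]

lemma continuous_re_eval (a : A) :
    Continuous fun x : PontryaginDual A => ((x a : Circle) : ℂ).re := by
  have h : Continuous fun x : PontryaginDual A => x a :=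
    continuous_eval_const (F := ContinuousMonoidHom A Circle) a
  exact Complex.continuous_re.comp (continuous_subtype_val.comp h)

lemma zhalfReal_hatFun (h2 : ∀ a : A, a * a = 1) (p : MonoidAlgebra ZHalf A)
    (x : PontryaginDual A) : zhalfReal (hatFun p x) =
      ∑ a ∈ p.coeff.support, zhalfReal (p.coeff a) * ((x a : Circle) : ℂ).re := by
  simp [hatFun, Finsupp.sum, map_sum, map_mul, zhalfReal_charValue h2]

lemma continuous_zhalfReal_hatFun (h2 : ∀ a : A, a * a = 1) (p : MonoidAlgebra ZHalf A) :
    Continuous fun x : PontryaginDual A => zhalfReal (hatFun p x) := by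
  simp only [zhalfReal_hatFun h2]
  exact continuous_finsetSum _ fun a _ => continuous_const.mul (continuous_re_eval a)

lemma IsProjection.zhalfReal_hatFun_eq {p : MonoidAlgebra ZHalf A} (hp : IsProjection p)
    (x : PontryaginDual A) :
    zhalfReal (hatFun p x) = (hatSupp p).indicator (fun _ => (1 : ℝ)) x := by
  rcases hp x with h | h <;> simp [hatSupp, Set.indicator, h]

variable [MeasurableSpace (PontryaginDual A)] [BorelSpace (PontryaginDual A)]

lemma IsProjection.measurableSet_hatSupp (h2 : ∀ a : A, a * a = 1) {p : MonoidAlgebra ZHalf A}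
    (hp : IsProjection p) : MeasurableSet (hatSupp p) := by
  have h : hatSupp p = (fun x => zhalfReal (hatFun p x)) ⁻¹' {1} := by
    ext x
    rcases hp x with h | h <;> simp [hatSupp, h]
  rw [h]
  exact (continuous_zhalfReal_hatFun h2 p).measurable (measurableSet_singleton 1)

variable (μ : Measure (PontryaginDual A)) [μ.IsHaarMeasure] [IsProbabilityMeasure μ]
  [DiscreteTopology A] {ι : Type*} (e : Additive A ≃+ (ι →₀ ZMod 2))

omit [μ.IsHaarMeasure] [DiscreteTopology A] in
lemma integrable_re_eval (a : A) :
    Integrable (fun x : PontryaginDual A => ((x a : Circle) : ℂ).re) μ := by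
  refine Integrable.of_bound (continuous_re_eval a).aestronglyMeasurable 1
    (ae_of_all _ fun x => ?_)
  have h := Complex.abs_re_le_norm ((x a : Circle) : ℂ)
  rwa [Circle.norm_coe] at h

-- Haar measure is invariant under translation by a character y with y(a) = -1, and this translation
-- negates the integrand. Such a y exists by injectivity of the Fourier transform.
omit [IsProbabilityMeasure μ] in
include e in
lemma integral_re_eval_eq_zero {a : A} (ha : a ≠ 1) :
    ∫ x : PontryaginDual A, ((x a : Circle) : ℂ).re ∂μ = 0 := by
  classical
  have h2 := mul_self_eq_one e
  obtain ⟨y, hy⟩ : ∃ y : PontryaginDual A, charValue y a ≠ 1 := by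
    by_contra! h
    apply ha
    have h1 : (MonoidAlgebra.single a 1 : MonoidAlgebra ZHalf A) = MonoidAlgebra.single 1 1 :=
      eq_of_hatFun_eq e fun x => by simp [hatFun, h, charValue_one]
    exact (MonoidAlgebra.single_left_inj one_ne_zero).1 h1
  have hy' : ((y a : Circle) : ℂ) = -1 := by
    rcases coe_char_eq h2 y a with h | h
    · simp [charValue, h] at hy
    · exact h
  have h := integral_mul_left_eq_self (μ := μ)
    (fun x : PontryaginDual A => ((x a : Circle) : ℂ).re) y
  have h' : ∀ x : PontryaginDual A, (((y * x) a : Circle) : ℂ).re = -((x a : Circle) : ℂ).re := by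
    intro x
    have : (y * x) a = y a * x a := rfl
    rw [this, Circle.coe_mul, hy']
    simp
  simp only [h', integral_neg] at h
  linarith

-- Integrate the transform term by term: only the trivial group element survives.
include e in
lemma IsProjection.measureReal_hatSupp {p : MonoidAlgebra ZHalf A} (hp : IsProjection p) :
    μ.real (hatSupp p) = zhalfReal (p.coeff 1) := by
  classical
  have h2 := mul_self_eq_one e
  rw [← integral_indicator_one (hp.measurableSet_hatSupp h2)]
  have h : (hatSupp p).indicator (1 : PontryaginDual A → ℝ) = fun x =>
      ∑ a ∈ p.coeff.support, zhalfReal (p.coeff a) * ((x a : Circle) : ℂ).re := by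
    ext x
    rw [← zhalfReal_hatFun h2, hp.zhalfReal_hatFun_eq]
    rfl
  rw [h, integral_finsetSum _ fun a _ => (integrable_re_eval μ a).const_mul _]
  simp only [integral_const_mul]
  rw [Finset.sum_eq_single 1]
  · have : ∀ x : PontryaginDual A, x 1 = 1 := fun x => map_one x
    simp [this]
  · intro a _ ha
    rw [integral_re_eval_eq_zero μ e ha, mul_zero]
  · intro h1
    rw [Finsupp.notMem_support_iff.1 h1]
    simp

end Haar

/-! ### The action on the group ring -/

section Action

variable {Γ : Type*} [Group Γ] {A : Type*} [CommGroup A] (φ : Γ →* MulAut A)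

lemma actOn_one (p : MonoidAlgebra ZHalf A) : actOn φ 1 p = p := by
  ext a
  simp [actOn, MonoidAlgebra.mapDomain]

lemma actOn_mul (γ δ : Γ) (p : MonoidAlgebra ZHalf A) :
    actOn φ (γ * δ) p = actOn φ γ (actOn φ δ p) := by
  ext a
  simp [actOn, MonoidAlgebra.mapDomain, ← Finsupp.mapDomain_comp, Function.comp_def]

lemma coeff_actOn_one (γ : Γ) (p : MonoidAlgebra ZHalf A) :
    (actOn φ γ p).coeff 1 = p.coeff 1 := by
  have := Finsupp.mapDomain_apply (φ γ).injective p.coeff 1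
  rwa [map_one] at this

/-- The inclusion `ℤ[1/2][A] → ℤ[1/2][Γ ⋉ A]`. -/
noncomputable def inlHom : MonoidAlgebra ZHalf A →+* MonoidAlgebra ZHalf (A ⋊[φ] Γ) :=
  MonoidAlgebra.mapDomainRingHom ZHalf SemidirectProduct.inl

/-- The inclusion `Γ → ℤ[1/2][Γ ⋉ A]`. -/
noncomputable def inrHom : Γ →* MonoidAlgebra ZHalf (A ⋊[φ] Γ) :=
  (MonoidAlgebra.of ZHalf (A ⋊[φ] Γ)).comp SemidirectProduct.inr

lemma inrHom_apply (γ : Γ) :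
    inrHom φ γ = MonoidAlgebra.single (SemidirectProduct.inr γ : A ⋊[φ] Γ) (1 : ZHalf) := rfl

lemma inlHom_apply (p : MonoidAlgebra ZHalf A) :
    inlHom φ p = MonoidAlgebra.mapDomain (SemidirectProduct.inl : A →* A ⋊[φ] Γ) p := rfl

/-- The crossed-product relation; by additivity it is enough to check it on monomials. -/
lemma inrHom_mul_inlHom (γ : Γ) (p : MonoidAlgebra ZHalf A) :
    inrHom φ γ * inlHom φ p = inlHom φ (actOn φ γ p) * inrHom φ γ := by
  have h : (AddMonoidHom.mulLeft (inrHom φ γ)).comp (inlHom φ).toAddMonoidHom =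
      ((AddMonoidHom.mulRight (inrHom φ γ)).comp (inlHom φ).toAddMonoidHom).comp
        (MonoidAlgebra.mapDomainRingHom ZHalf (φ γ).toMonoidHom).toAddMonoidHom := by
    refine MonoidAlgebra.addMonoidHom_ext fun a r => ?_
    have h1 : (SemidirectProduct.inr γ * SemidirectProduct.inl a : A ⋊[φ] Γ) =
        SemidirectProduct.inl (φ γ a) * SemidirectProduct.inr γ := by ext <;> simp
    simp [inrHom_apply, inlHom, MonoidAlgebra.single_mul_single, h1]
  exact DFunLike.congr_fun h p

end Action

/-! ### Simply connected graphs -/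

section SimplyConnected

variable {Γ : Type*} [Group Γ] {A : Type*} [CommGroup A] {φ : Γ →* MulAut A}
  [TopologicalSpace A] {l : ℕ} {T : Fin l → MonoidAlgebra ZHalf (A ⋊[φ] Γ)}
  {D : ∀ j, Decomposition φ (T j)} {G : Finset (MonoidAlgebra ZHalf A)}
  {p q r : MonoidAlgebra ZHalf A} {γ δ : Γ}

lemma HasPath.mem_left (h : HasPath D G p q γ) : p ∈ G := by
  induction h with
  | nil hp => exact hp
  | cons c h hc ih => exact ih

lemma HasPath.eq_actOn (h : HasPath D G p q γ) : q = actOn φ γ p := by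
  induction h with
  | nil hp => exact (actOn_one φ _).symm
  | cons c h hc ih => rw [actOn_mul, ← ih]

lemma IsFamilyEdge.actOn_mem (hG : ∀ j, IsTGraph (D j) G) (h : IsFamilyEdge D G p γ) :
    actOn φ γ p ∈ G := by
  obtain ⟨j, hp, i, rfl, hi⟩ := h
  exact (hG j).act_mem p hp i hi

lemma HasPath.mem_right (hG : ∀ j, IsTGraph (D j) G) (h : HasPath D G p q γ) : q ∈ G := by
  induction h with
  | nil hp => exact hp
  | cons c h hc ih =>
    rcases hc with hc | hc
    · exact hc.actOn_mem hG
    · obtain ⟨j, hp, -⟩ := hc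
      exact hp

lemma HasPath.trans (h : HasPath D G p q γ) (h' : HasPath D G q r δ) :
    HasPath D G p r (δ * γ) := by
  induction h' with
  | nil hp => simpa using h
  | cons c h' hc ih => rw [mul_assoc]; exact HasPath.cons c ih hc

lemma HasPath.symm (hG : ∀ j, IsTGraph (D j) G) (h : HasPath D G p q γ) :
    HasPath D G q p γ⁻¹ := by
  induction h with
  | nil hp => simpa using HasPath.nil hp
  | @cons q γ c h hc ih =>
    have hq : actOn φ c⁻¹ (actOn φ c q) = q := by rw [← actOn_mul, inv_mul_cancel, actOn_one]
    have hmem : actOn φ c q ∈ G := (HasPath.cons c h hc).mem_right hG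
    -- The last edge traversed backwards; exchanging the two alternatives of `hc` reverses it.
    have h1 := HasPath.cons (D := D) c⁻¹ (HasPath.nil hmem)
      (by rw [hq, inv_inv]; exact hc.symm)
    rw [hq, mul_one] at h1
    rw [mul_inv_rev]
    exact h1.trans ih

/-- Going along one path and back along the other closes up, and closed paths have trivial label. -/
lemma IsSimplyConnectedGraph.label_unique (hG : IsSimplyConnectedGraph D G)
    (h : HasPath D G p q γ) (h' : HasPath D G p q δ) : γ = δ := by
  have := hG.label_loop p h.mem_left _ (h.trans (h'.symm hG.isTGraph))
  exact (inv_mul_eq_one.1 this).symm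

/-- The base projection and the labels of the vertices of a simply connected graph. -/
structure GraphLabeling (D : ∀ j, Decomposition φ (T j)) (G : Finset (MonoidAlgebra ZHalf A)) where
  base : MonoidAlgebra ZHalf A
  label : MonoidAlgebra ZHalf A → Γ
  actOn_label : ∀ p ∈ G, actOn φ (label p) base = p
  label_edge : ∀ p ∈ G, ∀ j i, hatSupp p ⊆ hatSupp ((D j).f i) →
    label (actOn φ ((D j).γ i) p) = (D j).γ i * label p
  base_eq : G = ∅ ∧ base = 0 ∨ base ∈ G

/-- Labels are read off from paths starting at a chosen vertex. The empty graph gets base 0, so that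
it produces no blocks. -/
lemma IsSimplyConnectedGraph.nonempty_labeling (hG : IsSimplyConnectedGraph D G) :
    Nonempty (GraphLabeling D G) := by
  rcases G.eq_empty_or_nonempty with rfl | ⟨p₀, hp₀⟩
  · exact ⟨⟨0, 1, by simp, by simp, Or.inl ⟨rfl, rfl⟩⟩⟩
  have h : ∀ p, ∃ γ, p ∈ G → HasPath D G p₀ p γ := fun p => by
    by_cases hp : p ∈ G
    · obtain ⟨γ, hγ⟩ := hG.connected p₀ hp₀ p hp
      exact ⟨γ, fun _ => hγ⟩
    · exact ⟨1, fun h => absurd h hp⟩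
  choose g hg using h
  refine ⟨⟨p₀, g, fun p hp => ((hg p hp).eq_actOn).symm, fun p hp j i hi => ?_, Or.inr hp₀⟩⟩
  have he : IsFamilyEdge D G p ((D j).γ i) := ⟨j, hp, i, rfl, hi⟩
  exact hG.label_unique (hg _ (he.actOn_mem hG.isTGraph)) (HasPath.cons _ (hg p hp) (Or.inl he))

end SimplyConnected

/-! ### Vectors of `k[Γ ⋉ A]` attached to the vertices of a graph -/

section VertexVectors

variable {Γ : Type*} [Group Γ] {A : Type*} [CommGroup A] {φ : Γ →* MulAut A}
  [TopologicalSpace A] [DiscreteTopology A]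
  {ι : Type*} [DecidableEq ι] (e : Additive A ≃+ (ι →₀ ZMod 2)) (s : Finset ι)

include e in
lemma IsOrth.mul_eq_zero {p q : MonoidAlgebra ZHalf A} (h : IsOrth p q) : p * q = 0 := by
  refine eq_of_hatFun_eq e fun x => ?_
  rw [← hatHom_apply (mul_self_eq_one e), ← hatHom_apply (mul_self_eq_one e), map_mul, map_zero,
    hatHom_apply, hatHom_apply]
  by_cases hp : hatFun p x = 0
  · rw [hp, zero_mul]
  · have hq : hatFun q x = 0 := by
      by_contra hq
      exact Set.disjoint_left.1 h hp hq
    rw [hq, mul_zero]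

include e in
lemma hatSupp_nonempty {p : MonoidAlgebra ZHalf A} (hp : p ≠ 0) : (hatSupp p).Nonempty := by
  by_contra h
  rw [Set.not_nonempty_iff_eq_empty] at h
  refine hp (eq_of_hatFun_eq e fun x => ?_)
  have hx : x ∉ hatSupp p := by simp [h]
  simpa [hatSupp, hatFun] using hx

-- Makes it harmless that `adjCoeff` also sums over indices i for which p has no outgoing edge.
omit [DiscreteTopology A] in
lemma pairing_eq_zero {f p : MonoidAlgebra ZHalf A} (h : Disjoint (hatSupp p) (hatSupp f)) :
    pairing f p = 0 := by
  unfold pairing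
  split_ifs with hp
  · by_contra h0
    exact Set.disjoint_left.1 h hp.choose_spec h0
  · rfl

variable {l : ℕ} {T : Fin l → MonoidAlgebra ZHalf (A ⋊[φ] Γ)}
  {D : ∀ j, Decomposition φ (T j)} {G : Finset (MonoidAlgebra ZHalf A)}

-- Compare transforms: off supp p both sides vanish, and on supp p the transform of f_i is constant,
-- possibly zero.
include e in
lemma IsTGraph.mul_eq {t : MonoidAlgebra ZHalf (A ⋊[φ] Γ)} {D : Decomposition φ t}
    (hG : IsTGraph D G) {p : MonoidAlgebra ZHalf A} (hp : p ∈ G) (i : Fin D.m) :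
    D.f i * p = MonoidAlgebra.single 1 (pairing (D.f i) p) * p := by
  have hs := hatSupp_nonempty e (hG.projection p hp).2
  have hx : ∀ x ∈ hatSupp p, hatFun (D.f i) x = pairing (D.f i) p := by
    intro x hx
    rcases hG.dichotomy p hp i with h | h
    · rw [pairing, dif_pos hs]
      exact hG.constant p hp i h x hx _ hs.choose_spec
    · rw [pairing_eq_zero h]
      by_contra h0
      exact Set.disjoint_left.1 h hx h0
  refine eq_of_hatFun_eq e fun x => ?_
  rw [← hatHom_apply (mul_self_eq_one e), ← hatHom_apply (mul_self_eq_one e), map_mul, map_mul,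
    hatHom_apply, hatHom_apply, hatHom_apply]
  by_cases h : hatFun p x = 0
  · rw [h, mul_zero, mul_zero]
  · rw [hx x h]
    simp [hatFun, charValue_one]

/-- The element `γ_p E_w λ` of `ℤ[1/2][Γ ⋉ A]`, where `γ_p` is the label of a vertex `p` and `E_w`
the idempotent of a character. -/
noncomputable def vertexVec (L : GraphLabeling D G) (w : s → ZMod 2) (x : A ⋊[φ] Γ)
    (p : MonoidAlgebra ZHalf A) : MonoidAlgebra ZHalf (A ⋊[φ] Γ) :=
  inrHom φ (L.label p) * inlHom φ (cubeIdem e s w) * MonoidAlgebra.single x 1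

/-- A left multiplier isolating the vector of a vertex `p`. -/
noncomputable def vertexMul (L : GraphLabeling D G) (w : s → ZMod 2)
    (p : MonoidAlgebra ZHalf A) : MonoidAlgebra ZHalf (A ⋊[φ] Γ) :=
  inlHom φ (cubeIdem e s w) * inrHom φ (L.label p)⁻¹ * inlHom φ p

variable {s} {L : GraphLabeling D G}

/-- Moving p to the right past its label turns it into the base, which absorbs the idempotent. -/
lemma inlHom_mul_vertexVec (hL : L.base.coeff.support ⊆ cube e s) {w : s → ZMod 2}
    (hw : hatFun L.base (cubeChar e s w) = 1) (x : A ⋊[φ] Γ) {p : MonoidAlgebra ZHalf A}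
    (hp : p ∈ G) : inlHom φ p * vertexVec e s L w x p = vertexVec e s L w x p := by
  have h1 : L.base * cubeIdem e s w = cubeIdem e s w := by
    rw [mul_cubeIdem e s hL, hw]
    exact one_smul ZHalf (cubeIdem e s w)
  conv_rhs => rw [vertexVec, ← h1, map_mul, ← mul_assoc, inrHom_mul_inlHom, L.actOn_label p hp]
  simp only [vertexVec, mul_assoc]

omit [TopologicalSpace A] [DiscreteTopology A] in
open Classical in
lemma coeff_inlHom_mul_single (w : s → ZMod 2) (x y : A ⋊[φ] Γ)
    (h : ∀ a ∈ cube e s, SemidirectProduct.inl a * y = x → a = 1) :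
    (inlHom φ (cubeIdem e s w) * MonoidAlgebra.single y 1).coeff x =
      if x = y then zhalfHalf ^ s.card else 0 := by
  rw [MonoidAlgebra.coeff_mul_single_apply, mul_one, inlHom_apply]
  split_ifs with hxy
  · rw [hxy, mul_inv_cancel, ← map_one (SemidirectProduct.inl : A →* A ⋊[φ] Γ),
      ← coeff_cubeIdem_one e s w]
    exact Finsupp.mapDomain_apply SemidirectProduct.inl_injective _ _
  · by_contra h0
    have hm := Finsupp.mapDomain_support (Finsupp.mem_support_iff.2 h0)
    obtain ⟨a, ha, hax⟩ := Finset.mem_image.1 hm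
    have h1 := h a (support_cubeIdem_subset e s w ha) (by rw [hax]; group)
    rw [h1, map_one] at hax
    exact hxy (mul_inv_eq_one.1 hax.symm)

lemma vertexMul_mul_vertexVec (hL : L.base.coeff.support ⊆ cube e s) (w : s → ZMod 2)
    {w' : s → ZMod 2} (hw' : hatFun L.base (cubeChar e s w') = 1) (x : A ⋊[φ] Γ)
    {p : MonoidAlgebra ZHalf A} (hp : p ∈ G) :
    vertexMul e s L w p * vertexVec e s L w' x p =
      if w = w' then inlHom φ (cubeIdem e s w) * MonoidAlgebra.single x 1 else 0 := by
  rw [vertexMul, mul_assoc, inlHom_mul_vertexVec e hL hw' x hp, vertexVec, mul_assoc,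
    ← mul_assoc (inrHom φ (L.label p)⁻¹), ← mul_assoc (inrHom φ (L.label p)⁻¹), ← map_mul,
    inv_mul_cancel, map_one, one_mul, ← mul_assoc, ← map_mul, cubeIdem_mul_cubeIdem]
  split_ifs
  · rfl
  · rw [map_zero, zero_mul]

lemma vertexMul_mul_vertexVec_of_isOrth {G' : Finset (MonoidAlgebra ZHalf A)}
    {L' : GraphLabeling D G'} (hL : L'.base.coeff.support ⊆ cube e s) (w : s → ZMod 2)
    {w' : s → ZMod 2} (hw' : hatFun L'.base (cubeChar e s w') = 1) (x : A ⋊[φ] Γ)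
    {p q : MonoidAlgebra ZHalf A} (hq : q ∈ G') (hpq : IsOrth p q) :
    vertexMul e s L w p * vertexVec e s L' w' x q = 0 := by
  rw [← inlHom_mul_vertexVec e hL hw' x hq, vertexMul, mul_assoc, ← mul_assoc (inlHom φ p),
    ← map_mul, hpq.mul_eq_zero e, map_zero, zero_mul, mul_zero]

omit [DiscreteTopology A] in
lemma exists_of_coeff_vertexVec_ne_zero {w : s → ZMod 2} {x y : A ⋊[φ] Γ}
    {p : MonoidAlgebra ZHalf A} (h : (vertexVec e s L w x p).coeff y ≠ 0) :
    ∃ a ∈ cube e s, y = SemidirectProduct.inr (L.label p) * SemidirectProduct.inl a * x := by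
  classical
  rw [vertexVec, MonoidAlgebra.coeff_mul_single_apply, mul_one, inrHom_apply,
    MonoidAlgebra.coeff_single_mul_apply, one_mul, inlHom_apply] at h
  have hm := Finsupp.mapDomain_support (Finsupp.mem_support_iff.2 h)
  obtain ⟨a, ha, hax⟩ := Finset.mem_image.1 hm
  exact ⟨a, support_cubeIdem_subset e s w ha, by rw [hax]; group⟩

/-- Insert p in front of the vector, replace f_i p by a scalar multiple of p, and absorb γ_i into
the label. Consistency of labels along edges keeps the same w and x, so the block is invariant. -/
lemma mul_vertexVec (hL : L.base.coeff.support ⊆ cube e s) {w : s → ZMod 2}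
    (hw : hatFun L.base (cubeChar e s w) = 1) (x : A ⋊[φ] Γ) {p : MonoidAlgebra ZHalf A}
    (hp : p ∈ G) (j : Fin l) (hG : IsTGraph (D j) G) :
    T j * vertexVec e s L w x p =
      ∑ i, MonoidAlgebra.single 1 (pairing ((D j).f i) p) *
        vertexVec e s L w x (actOn φ ((D j).γ i) p) := by
  conv_lhs => rw [(D j).eq_sum, Finset.sum_mul]
  refine Finset.sum_congr rfl fun i _ => ?_
  have h1 : ∀ r : ZHalf, inlHom φ (MonoidAlgebra.single 1 r) = MonoidAlgebra.single 1 r := by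
    intro r
    simp [inlHom_apply]
  have hc : ∀ (r : ZHalf) (z : MonoidAlgebra ZHalf (A ⋊[φ] Γ)),
      z * MonoidAlgebra.single 1 r = MonoidAlgebra.single 1 r * z := by
    intro r z
    exact (Algebra.commutes r z).symm
  change inrHom φ ((D j).γ i) * inlHom φ ((D j).f i) * _ = _
  rw [← inlHom_mul_vertexVec e hL hw x hp, ← mul_assoc, mul_assoc (inrHom φ _), ← map_mul,
    hG.mul_eq e hp i, map_mul, h1, ← mul_assoc, hc, mul_assoc, mul_assoc,
    inlHom_mul_vertexVec e hL hw x hp]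
  rcases hG.dichotomy p hp i with h | h
  · congr 1
    rw [vertexVec, vertexVec, L.label_edge p hp j i h, map_mul]
    simp only [mul_assoc]
  · rw [pairing_eq_zero h, MonoidAlgebra.single_zero, zero_mul, zero_mul]

variable (k : Type*) [Field k] (hk : ringChar k ≠ 2)

/-- The reduction `ℤ[1/2][Γ ⋉ A] → k[Γ ⋉ A]`. -/
noncomputable def reductionHom (k : Type*) [Field k] (hk : ringChar k ≠ 2) (Λ : Type*) [Group Λ] :
    MonoidAlgebra ZHalf Λ →+* MonoidAlgebra k Λ :=
  MonoidAlgebra.mapRingHom Λ (zhalfReduction k hk)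

lemma coeff_reductionHom {Λ : Type*} [Group Λ] (z : MonoidAlgebra ZHalf Λ) (x : Λ) :
    (reductionHom k hk Λ z).coeff x = zhalfReduction k hk (z.coeff x) := by
  simp [reductionHom]

lemma reductionHom_mul_vertexVec (hL : L.base.coeff.support ⊆ cube e s) {w : s → ZMod 2}
    (hw : hatFun L.base (cubeChar e s w) = 1) (x : A ⋊[φ] Γ) (p : G)
    (j : Fin l) (hG : IsTGraph (D j) G) :
    reductionHom k hk _ (T j) * reductionHom k hk _ (vertexVec e s L w x p) =
      ∑ q : G, adjCoeff k hk (D j) p.1 q.1 • reductionHom k hk _ (vertexVec e s L w x q) := by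
  classical
  have hs : ∀ (c : ZHalf) (z : MonoidAlgebra ZHalf (A ⋊[φ] Γ)),
      reductionHom k hk _ (MonoidAlgebra.single 1 c * z) =
        zhalfReduction k hk c • reductionHom k hk _ z := by
    intro c z
    rw [map_mul, reductionHom, MonoidAlgebra.mapRingHom_single, Algebra.smul_def]
    rfl
  rw [← map_mul, mul_vertexVec e hL hw x p.2 j hG, map_sum]
  simp only [hs]
  have hq : ∀ q : G, adjCoeff k hk (D j) p.1 q.1 • reductionHom k hk _ (vertexVec e s L w x q) =
      ∑ i, if actOn φ ((D j).γ i) p = q then zhalfReduction k hk (pairing ((D j).f i) p) •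
        reductionHom k hk _ (vertexVec e s L w x q) else 0 := by
    intro q
    rw [adjCoeff, Finset.sum_smul, Finset.sum_filter]
  simp only [hq]
  rw [Finset.sum_comm]
  refine Finset.sum_congr rfl fun i _ => ?_
  rcases hG.dichotomy p p.2 i with h | h
  · have hm := hG.act_mem p p.2 i h
    rw [Finset.sum_eq_single ⟨_, hm⟩, if_pos rfl]
    · intro q _ hq
      rw [if_neg]
      intro h'
      exact hq (Subtype.ext h'.symm)
    · simp
  · simp [pairing_eq_zero h]

end VertexVectors

/-! ### Linear independence of the vertex vectors -/

section Independence

variable {Γ : Type*} [Group Γ] {A : Type*} [CommGroup A] {φ : Γ →* MulAut A}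
  [TopologicalSpace A] [DiscreteTopology A]
  {ι : Type*} [DecidableEq ι] (e : Additive A ≃+ (ι →₀ ZMod 2)) (s : Finset ι)
  {l : ℕ} {T : Fin l → MonoidAlgebra ZHalf (A ⋊[φ] Γ)} {D : ∀ j, Decomposition φ (T j)}
  {I : Type*} {G : I → Finset (MonoidAlgebra ZHalf A)} (L : ∀ i, GraphLabeling D (G i))
  (R : Finset (A ⋊[φ] Γ))

/-- The characters of a cube in the support of the base of a graph, together with a set of
representatives. -/
abbrev BlockIndex {G : Finset (MonoidAlgebra ZHalf A)} (L : GraphLabeling D G) : Type _ :=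
  {w : s → ZMod 2 // hatFun L.base (cubeChar e s w) = 1} × R

/-- The family of the vectors of all vertices of a family of graphs. -/
noncomputable def blockVec (t : Σ i, BlockIndex e s R (L i) × G i) :
    MonoidAlgebra ZHalf (A ⋊[φ] Γ) :=
  vertexVec e s (L t.1) t.2.1.1.1 t.2.1.2 t.2.2

lemma zhalfReduction_half_pow_ne_zero (k : Type*) [Field k] (hk : ringChar k ≠ 2) (n : ℕ) :
    zhalfReduction k hk (zhalfHalf ^ n) ≠ 0 := by
  intro h
  have h1 := congrArg (zhalfReduction k hk) (zhalfHalf_pow_mul n)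
  rw [map_mul, h, zero_mul, map_one] at h1
  exact zero_ne_one h1

lemma linearIndependent_blockVec (k : Type*) [Field k] (hk : ringChar k ≠ 2)
    (hL : ∀ i, (L i).base.coeff.support ⊆ cube e s)
    (horth : ∀ i i', ∀ p ∈ G i, ∀ q ∈ G i', (i ≠ i' ∨ p ≠ q) → IsOrth p q)
    (hR : ∀ x ∈ R, ∀ y ∈ R, ∀ a ∈ cube e s, SemidirectProduct.inl a * y = x → x = y) :
    LinearIndependent k fun t => reductionHom k hk _ (blockVec e s L R t) := by
  classical
  -- A dual family: up to the factor 2^(-|s|), which is nonzero in k, `f t` reads off the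
  -- coefficient of the vector indexed by t. Orthogonality separates vertices, idempotents separate
  -- characters, and distinct cosets separate representatives.
  let f : (Σ i, BlockIndex e s R (L i) × G i) → MonoidAlgebra k (A ⋊[φ] Γ) → k := fun t z =>
    (reductionHom k hk _ (vertexMul e s (L t.1) t.2.1.1.1 t.2.2) * z).coeff t.2.1.2
  have hf : ∀ t t', f t (reductionHom k hk _ (blockVec e s L R t')) =
      if t = t' then zhalfReduction k hk (zhalfHalf ^ s.card) else 0 := by
    rintro ⟨i, ⟨⟨w, hw⟩, ⟨x, hx⟩⟩, ⟨p, hp⟩⟩ ⟨i', ⟨⟨w', hw'⟩, ⟨x', hx'⟩⟩, ⟨p', hp'⟩⟩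
    simp only [f, blockVec]
    rw [← map_mul, coeff_reductionHom]
    by_cases h : i ≠ i' ∨ p ≠ p'
    · rw [vertexMul_mul_vertexVec_of_isOrth e (hL i') w hw' x' hp' (horth i i' p hp p' hp' h),
        if_neg]
      · simp
      · rintro heq
        cases heq
        simp at h
    · push Not at h
      obtain ⟨rfl, rfl⟩ := h
      rw [vertexMul_mul_vertexVec e (hL i) w hw' x' hp]
      by_cases hww : w = w'
      · subst hww
        rw [if_pos rfl, coeff_inlHom_mul_single]
        · by_cases hxx : x = x'
          · subst hxx
            simp
          · rw [if_neg hxx, if_neg, map_zero]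
            intro heq
            cases heq
            exact hxx rfl
        · intro a ha h
          have := hR x hx x' hx' a ha h
          rw [this, mul_eq_right] at h
          exact SemidirectProduct.inl_injective (h.trans (map_one _).symm)
      · rw [if_neg hww, if_neg]
        · simp
        · intro heq
          cases heq
          exact hww rfl
  rw [linearIndependent_iff']
  intro S g hg t ht
  have h1 : f t (∑ t' ∈ S, g t' • reductionHom k hk _ (blockVec e s L R t')) =
      ∑ t' ∈ S, g t' * f t (reductionHom k hk _ (blockVec e s L R t')) := by
    simp only [f, Finset.mul_sum, MonoidAlgebra.coeff_sum, Finsupp.finsetSum_apply,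
      mul_smul_comm, MonoidAlgebra.coeff_smul, Finsupp.smul_apply, smul_eq_mul]
  rw [hg] at h1
  simp only [hf] at h1
  have h0 : f t 0 = 0 := by simp [f]
  rw [h0] at h1
  rw [Finset.sum_eq_single t (fun t' _ h => by rw [if_neg (Ne.symm h), mul_zero])
    (fun h => absurd ht h), if_pos rfl] at h1
  exact (mul_eq_zero.1 h1.symm).resolve_right (zhalfReduction_half_pow_ne_zero k hk _)

end Independence

/-! ### Kernels of operators intertwined with block sums -/

section Blocks

variable {k : Type*} [Field k] {I : Type*} [Fintype I] {l : ℕ}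

/-- An operator intertwined, by injective maps, with a direct sum of copies of the operators `M i`
has a kernel of dimension bounded below and above by the kernels of the blocks. -/
lemma finrank_ker_bounds_of_intertwining {E E' : Type*} [AddCommGroup E] [Module k E]
    [AddCommGroup E'] [Module k E'] [FiniteDimensional k E] {J : I → Type*} [∀ i, Fintype (J i)]
    {V : I → Type*} [∀ i, AddCommGroup (V i)] [∀ i, Module k (V i)]
    [∀ i, FiniteDimensional k (V i)] (M : ∀ i, V i →ₗ[k] (Fin l → V i))
    (θ : (∀ i, J i → V i) →ₗ[k] E) (hθ : Function.Injective θ)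
    (θ' : (∀ i, J i → V i) →ₗ[k] E') (hθ' : Function.Injective θ')
    (L : E →ₗ[k] (Fin l → E')) (hL : ∀ v j, L (θ v) j = θ' fun i s => M i (v i s) j) :
    ∑ i, Fintype.card (J i) * Module.finrank k (LinearMap.ker (M i)) ≤
        Module.finrank k (LinearMap.ker L) ∧
      ∑ i, Fintype.card (J i) * Module.finrank k (V i) + Module.finrank k (LinearMap.ker L) ≤
        Module.finrank k E +
          ∑ i, Fintype.card (J i) * Module.finrank k (LinearMap.ker (M i)) := by
  have hker : ∀ v, L (θ v) = 0 ↔ ∀ i s, M i (v i s) = 0 := by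
    intro v
    constructor
    · intro h i s
      ext j
      have h1 : θ' (fun i s => M i (v i s) j) = 0 := by rw [← hL, h]; rfl
      exact congrFun (congrFun ((map_eq_zero_iff θ' hθ').1 h1) i) s
    · intro h
      ext j
      rw [hL]
      simp only [h, Pi.zero_apply]
      exact map_zero θ'
  -- Since θ' is injective, the kernel of L ∘ θ is the direct sum of the block kernels.
  let κ : (∀ i, J i → LinearMap.ker (M i)) →ₗ[k] LinearMap.ker (L ∘ₗ θ) :=
    { toFun := fun u => ⟨fun i s => u i s, by
        rw [LinearMap.mem_ker, LinearMap.comp_apply, hker]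
        exact fun i s => (u i s).2⟩
      map_add' := fun _ _ => rfl
      map_smul' := fun _ _ => rfl }
  have hκ : Function.Bijective κ := by
    constructor
    · intro u v h
      ext i s
      exact congrFun (congrFun (congrArg Subtype.val h) i) s
    · rintro ⟨v, hv⟩
      rw [LinearMap.mem_ker, LinearMap.comp_apply, hker] at hv
      exact ⟨fun i s => ⟨v i s, hv i s⟩, rfl⟩
  have h1 : Module.finrank k (LinearMap.ker (L ∘ₗ θ)) =
      ∑ i, Fintype.card (J i) * Module.finrank k (LinearMap.ker (M i)) := by
    rw [← (LinearEquiv.ofBijective κ hκ).finrank_eq, Module.finrank_pi_fintype]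
    simp [Module.finrank_pi_fintype]
  have h2 : Module.finrank k (∀ i, J i → V i) =
      ∑ i, Fintype.card (J i) * Module.finrank k (V i) := by
    rw [Module.finrank_pi_fintype]
    simp [Module.finrank_pi_fintype]
  have h3 := LinearMap.finrank_range_add_finrank_ker (L ∘ₗ θ)
  have h4 := LinearMap.finrank_range_add_finrank_ker L
  have h5 : Module.finrank k (LinearMap.range (L ∘ₗ θ)) ≤ Module.finrank k (LinearMap.range L) :=
    Submodule.finrank_mono (LinearMap.range_comp_le_range θ L)
  have h6 : Module.finrank k (LinearMap.ker (L ∘ₗ θ)) ≤ Module.finrank k (LinearMap.ker L) := by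
    refine LinearMap.finrank_le_finrank_of_injective
      (f := θ.restrict (p := LinearMap.ker (L ∘ₗ θ)) (q := LinearMap.ker L) fun v hv => hv) ?_
    intro u v h
    exact Subtype.ext (hθ (congrArg Subtype.val h))
  -- Rank-nullity for L ∘ θ and for L, with rank (L ∘ θ) ≤ rank L, gives the second bound.
  rw [← h1, ← h2]
  omega

/-- The map from a block sum defined by a family of vectors. -/
noncomputable def blockMap {E : Type*} [AddCommGroup E] [Module k E] {J G : I → Type*}
    [∀ i, Fintype (J i)] [∀ i, Fintype (G i)] (b : (Σ i, J i × G i) → E) :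
    (∀ i, J i → G i →₀ k) →ₗ[k] E :=
  Fintype.linearCombination k b ∘ₗ LinearMap.pi fun t =>
    Finsupp.lapply t.2.2 ∘ₗ LinearMap.proj t.2.1 ∘ₗ LinearMap.proj t.1

lemma blockMap_apply {E : Type*} [AddCommGroup E] [Module k E] {J G : I → Type*}
    [∀ i, Fintype (J i)] [∀ i, Fintype (G i)] (b : (Σ i, J i × G i) → E)
    (v : ∀ i, J i → G i →₀ k) :
    blockMap b v = ∑ i, ∑ s, ∑ p, v i s p • b ⟨i, s, p⟩ := by
  simp [blockMap, Fintype.linearCombination_apply, Fintype.sum_sigma, Fintype.sum_prod_type]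

lemma blockMap_injective {E : Type*} [AddCommGroup E] [Module k E] {J G : I → Type*}
    [∀ i, Fintype (J i)] [∀ i, Fintype (G i)] {b : (Σ i, J i × G i) → E}
    (hb : LinearIndependent k b) : Function.Injective (blockMap (k := k) b) := by
  have h := hb.fintypeLinearCombination_injective
  refine h.comp fun u v h => ?_
  ext i s p
  exact congrFun h ⟨i, s, p⟩

lemma finrank_ker_bounds_of_linearIndependent {E E' : Type*} [AddCommGroup E] [Module k E]
    [AddCommGroup E'] [Module k E'] [FiniteDimensional k E] {J G : I → Type*}
    [∀ i, Fintype (J i)] [∀ i, Fintype (G i)] (m : ∀ i, Fin l → G i → G i → k)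
    (M : ∀ i, (G i →₀ k) →ₗ[k] (Fin l → (G i →₀ k)))
    (hM : ∀ i v j q, M i v j q = ∑ p, v p * m i j p q)
    (b : (Σ i, J i × G i) → E) (hb : LinearIndependent k b)
    (b' : (Σ i, J i × G i) → E') (hb' : LinearIndependent k b')
    (L : E →ₗ[k] (Fin l → E'))
    (hL : ∀ i s p j, L (b ⟨i, s, p⟩) j = ∑ q, m i j p q • b' ⟨i, s, q⟩) :
    ∑ i, Fintype.card (J i) * Module.finrank k (LinearMap.ker (M i)) ≤
        Module.finrank k (LinearMap.ker L) ∧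
      ∑ i, Fintype.card (J i) * Fintype.card (G i) + Module.finrank k (LinearMap.ker L) ≤
        Module.finrank k E +
          ∑ i, Fintype.card (J i) * Module.finrank k (LinearMap.ker (M i)) := by
  have h := finrank_ker_bounds_of_intertwining M (blockMap b) (blockMap_injective hb)
    (blockMap b') (blockMap_injective hb') L ?_
  · simpa [Module.finrank_finsupp_self] using h
  intro v j
  rw [blockMap_apply, blockMap_apply]
  simp only [map_sum, map_smul, Finset.sum_apply, Pi.smul_apply, hL, hM, Finset.smul_sum,
    Finset.sum_smul, mul_smul]
  refine Finset.sum_congr rfl fun i _ => Finset.sum_congr rfl fun s _ => ?_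
  exact Finset.sum_comm

end Blocks

/-! ### Compressions -/

section Compression

variable {k : Type*} [Field k] {Λ : Type*} [Group Λ]

lemma finInclusion_finProjection {Φ : Finset Λ} {y : MonoidAlgebra k Λ}
    (hy : ∀ x, y.coeff x ≠ 0 → x ∈ Φ) : finInclusion k Φ (finProjection k Φ y) = y := by
  ext x
  have h : (finInclusion k Φ (finProjection k Φ y)).coeff =
      Finsupp.mapDomain Subtype.val (Finsupp.subtypeDomain (· ∈ Φ) y.coeff) := rfl
  rw [h]
  by_cases hx : x ∈ Φ
  · exact Finsupp.mapDomain_apply Subtype.val_injective _ (⟨x, hx⟩ : Φ)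
  · rw [Finsupp.mapDomain_of_notMem_range]
    · by_contra h0
      exact hx (hy x (Ne.symm h0))
    · rintro ⟨z, rfl⟩
      exact hx z.2

lemma compression_apply_const {l : ℕ} (T : Matrix (Fin l) (Fin 1) (MonoidAlgebra k Λ))
    {Φ : Finset Λ} {y : MonoidAlgebra k Λ} (hy : ∀ x, y.coeff x ≠ 0 → x ∈ Φ) (j : Fin l) :
    compression T Φ (fun _ => finProjection k Φ y) j = finProjection k Φ (T j 0 * y) := by
  simp [compression, matrixOperator, finInclusion_finProjection hy]

lemma linearIndependent_finProjection {ι : Type*} {Φ : Finset Λ} {b : ι → MonoidAlgebra k Λ}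
    (hb : LinearIndependent k b) (hΦ : ∀ t x, (b t).coeff x ≠ 0 → x ∈ Φ) :
    LinearIndependent k fun t => finProjection k Φ (b t) := by
  refine LinearIndependent.of_comp (finInclusion k Φ) ?_
  have : (finInclusion k Φ) ∘ (fun t => finProjection k Φ (b t)) = b :=
    funext fun t => finInclusion_finProjection (hΦ t)
  rwa [this]

end Compression

/-! ### Interiors of Følner sets -/

section Interior

variable {Λ : Type*} [Group Λ]

open Classical in
/-- The points of `Φ` whose translates by a finite set stay in `Φ`. -/
noncomputable def folnerInterior (S Φ : Finset Λ) : Finset Λ :=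
  Φ.filter fun x => ∀ σ ∈ S, σ * x ∈ Φ

lemma mem_folnerInterior {S Φ : Finset Λ} {x : Λ} :
    x ∈ folnerInterior S Φ ↔ x ∈ Φ ∧ ∀ σ ∈ S, σ * x ∈ Φ := by
  classical
  exact Finset.mem_filter

lemma mem_folnerBoundary {S Φ : Finset Λ} {x : Λ} :
    x ∈ folnerBoundary S Φ ↔ (∃ σ ∈ S, ∃ y ∈ Φ, σ * y = x) ∧ x ∉ Φ := by
  classical
  rw [folnerBoundary, Finset.mem_sdiff, Finset.mem_mul]

/-- A point outside the interior is σ⁻¹ times a boundary point for some σ in S. -/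
lemma card_le_card_folnerInterior_add (S Φ : Finset Λ) :
    Φ.card ≤ (folnerInterior S Φ).card + S.card * (folnerBoundary S Φ).card := by
  classical
  have h : Φ ⊆ folnerInterior S Φ ∪ S.biUnion fun σ => (folnerBoundary S Φ).image (σ⁻¹ * ·) := by
    intro x hx
    by_cases h : ∀ σ ∈ S, σ * x ∈ Φ
    · exact Finset.mem_union_left _ (mem_folnerInterior.2 ⟨hx, h⟩)
    · push Not at h
      obtain ⟨σ, hσ, hσx⟩ := h
      refine Finset.mem_union_right _ (Finset.mem_biUnion.2 ⟨σ, hσ, Finset.mem_image.2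
        ⟨σ * x, ?_, by simp⟩⟩)
      exact mem_folnerBoundary.2 ⟨⟨σ, hσ, x, hx, rfl⟩, hσx⟩
  refine (Finset.card_le_card h).trans ((Finset.card_union_le _ _).trans ?_)
  gcongr
  exact Finset.card_biUnion_le_card_mul _ _ _ fun σ _ => Finset.card_image_le

lemma folnerInterior_subset (S Φ : Finset Λ) : folnerInterior S Φ ⊆ Φ := by
  classical
  exact Finset.filter_subset _ _

lemma IsFolnerSeq.tendsto_card_interior {Φ : ℕ → Finset Λ} (hΦ : IsFolnerSeq Φ) (S : Finset Λ) :
    Tendsto (fun n => ((folnerInterior S (Φ n)).card : ℝ) / ((Φ n).card : ℝ)) atTop (𝓝 1) := by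
  have h := (hΦ.2 S).const_mul (S.card : ℝ)
  have h' : Tendsto (fun n => 1 - (S.card : ℝ) *
      (((folnerBoundary S (Φ n)).card : ℝ) / ((Φ n).card : ℝ))) atTop (𝓝 1) := by
    simpa using h.const_sub 1
  have hpos : ∀ n, (0 : ℝ) < (Φ n).card := fun n => by exact_mod_cast (hΦ.1 n).card_pos
  refine tendsto_of_tendsto_of_tendsto_of_le_of_le h' tendsto_const_nhds (fun n => ?_) fun n => ?_
  · have h1 : ((Φ n).card : ℝ) ≤ (folnerInterior S (Φ n)).card +
        S.card * (folnerBoundary S (Φ n)).card := by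
      exact_mod_cast card_le_card_folnerInterior_add S (Φ n)
    dsimp only
    rw [le_div_iff₀ (hpos n), sub_mul, mul_assoc, div_mul_cancel₀ _ (hpos n).ne']
    linarith
  · dsimp only
    rw [div_le_one (hpos n)]
    exact_mod_cast Finset.card_le_card (folnerInterior_subset S (Φ n))

/-- A set of representatives modulo left translation by a finite subgroup. -/
lemma exists_representatives (H Ψ : Finset Λ) (h1 : 1 ∈ H)
    (hmul : ∀ a ∈ H, ∀ b ∈ H, a * b ∈ H) (hinv : ∀ a ∈ H, a⁻¹ ∈ H) :
    ∃ R ⊆ Ψ, Ψ.card ≤ H.card * R.card ∧ ∀ x ∈ R, ∀ y ∈ R, ∀ a ∈ H, a * y = x → x = y := by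
  classical
  -- The coset Hx; R takes one point of Ψ from each coset meeting Ψ.
  let π : Λ → Finset Λ := fun x => H.image (· * x)
  have hπ : ∀ x y, π x = π y → ∃ a ∈ H, a * y = x := by
    intro x y h
    have hx : x ∈ π x := Finset.mem_image.2 ⟨1, h1, one_mul x⟩
    rw [h] at hx
    exact Finset.mem_image.1 hx
  have hπ' : ∀ x y, ∀ a ∈ H, a * y = x → π x = π y := by
    rintro x y a ha rfl
    ext z
    simp only [π, Finset.mem_image]
    constructor
    · rintro ⟨b, hb, rfl⟩
      exact ⟨b * a, hmul b hb a ha, by group⟩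
    · rintro ⟨b, hb, rfl⟩
      exact ⟨b * a⁻¹, hmul b hb _ (hinv a ha), by group⟩
  obtain ⟨R, hR, hinj, himg⟩ : ∃ R ⊆ Ψ, Set.InjOn π R ∧ R.image π = Ψ.image π := by
    obtain ⟨R, hR, hinj, himg⟩ := Finset.exists_subset_injOn_image_eq_of_surjOn (f := π) Ψ
      (Ψ.image π) (by rw [Finset.coe_image]; exact Set.surjOn_image _ _)
    exact ⟨R, by exact_mod_cast hR, hinj, himg⟩
  refine ⟨R, hR, ?_, fun x hx y hy a ha h => hinj hx hy (hπ' x y a ha h)⟩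
  have hc : R.card = (Ψ.image π).card := by rw [← himg, Finset.card_image_of_injOn hinj]
  rw [hc]
  refine Finset.card_le_mul_card_image Ψ H.card fun z hz => ?_
  obtain ⟨y, -, rfl⟩ := Finset.mem_image.1 hz
  refine (Finset.card_le_card (t := H.image (· * y)) fun x hx => ?_).trans Finset.card_image_le
  obtain ⟨a, ha, h⟩ := hπ x y (Finset.mem_filter.1 hx).2
  exact Finset.mem_image.2 ⟨a, ha, h⟩

end Interior

/-! ### Amenability of the semidirect product -/

section Amenable

variable {Γ : Type*} [Group Γ] {A : Type*} [CommGroup A] {φ : Γ →* MulAut A}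
  {ι : Type*} (e : Additive A ≃+ (ι →₀ ZMod 2))

open Classical in
/-- The set of products `γ a` with `γ ∈ Φ` and `a ∈ C`. -/
noncomputable def productSet (φ : Γ →* MulAut A) (Φ : Finset Γ) (C : Finset A) :
    Finset (A ⋊[φ] Γ) :=
  (Φ ×ˢ C).image fun x => SemidirectProduct.inr x.1 * SemidirectProduct.inl x.2

lemma mem_productSet {Φ : Finset Γ} {C : Finset A} {x : A ⋊[φ] Γ} :
    x ∈ productSet φ Φ C ↔
      ∃ γ ∈ Φ, ∃ a ∈ C, SemidirectProduct.inr γ * SemidirectProduct.inl a = x := by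
  simp [productSet, and_assoc]

lemma card_productSet (Φ : Finset Γ) (C : Finset A) :
    (productSet φ Φ C).card = Φ.card * C.card := by
  classical
  rw [productSet, Finset.card_image_of_injective, Finset.card_product]
  rintro ⟨γ, a⟩ ⟨δ, b⟩ h
  have h1 := congrArg SemidirectProduct.right h
  have h2 := congrArg SemidirectProduct.left h
  simp at h1
  subst h1
  simp at h2
  rw [h2]

lemma mul_inr_mul_inl (σ : A ⋊[φ] Γ) (γ : Γ) (a : A) :
    σ * (SemidirectProduct.inr γ * SemidirectProduct.inl a) =
      SemidirectProduct.inr (σ.right * γ) *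
        SemidirectProduct.inl (φ (σ.right * γ)⁻¹ σ.left * a) := by
  ext
  · simp only [SemidirectProduct.mul_left, SemidirectProduct.left_inr, SemidirectProduct.right_inr,
      SemidirectProduct.left_inl, one_mul, map_mul, map_inv]
    simp
  · simp

-- Multiply a Følner set of Γ by a cube so large that left translation by the first n elements of
-- the group changes the A-coordinate only within the cube. The boundary then comes from Γ alone.
include e in
lemma IsAmenableGroup.semidirectProduct [Countable Γ] [Countable A] (hΓ : IsAmenableGroup Γ) :
    IsAmenableGroup (A ⋊[φ] Γ) := by
  classical
  obtain ⟨Φ, hΦ⟩ := hΓ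
  have hcount : Countable (A ⋊[φ] Γ) := SemidirectProduct.equivProd.countable_iff.2 inferInstance
  obtain ⟨f, hf⟩ := exists_surjective_nat (A ⋊[φ] Γ)
  have hs : ∀ n, ∃ s : Finset ι, ((((Finset.range n).image f) ×ˢ Φ n).image fun x =>
      φ (x.1.right * x.2)⁻¹ x.1.left) ⊆ cube e s := fun n => exists_subset_cube e _
  choose s hs using hs
  refine ⟨fun n => productSet φ (Φ n) (cube e (s n)), fun n => ?_, fun S => ?_⟩
  · rw [← Finset.card_pos, card_productSet]
    exact Nat.mul_pos (hΦ.1 n).card_pos (Finset.card_pos.2 ⟨1, one_mem_cube e _⟩)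
  have hev : ∀ᶠ n in atTop, S ⊆ (Finset.range n).image f := by
    have h1 : ∀ σ ∈ S, ∀ᶠ n in atTop, σ ∈ (Finset.range n).image f := by
      intro σ _
      obtain ⟨m, rfl⟩ := hf σ
      filter_upwards [eventually_gt_atTop m] with n hn
      exact Finset.mem_image_of_mem f (Finset.mem_range.2 hn)
    filter_upwards [(Finset.eventually_all S).2 h1] with n hn σ hσ using hn σ hσ
  refine tendsto_of_tendsto_of_tendsto_of_le_of_le' tendsto_const_nhds
    (hΦ.2 (S.image SemidirectProduct.right)) (Eventually.of_forall fun n => by positivity) ?_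
  filter_upwards [hev] with n hn
  have hsub : folnerBoundary S (productSet φ (Φ n) (cube e (s n))) ⊆
      productSet φ (folnerBoundary (S.image SemidirectProduct.right) (Φ n)) (cube e (s n)) := by
    intro x hx
    obtain ⟨⟨σ, hσ, y, hy, rfl⟩, hx'⟩ := mem_folnerBoundary.1 hx
    obtain ⟨γ, hγ, a, ha, rfl⟩ := mem_productSet.1 hy
    rw [mul_inr_mul_inl] at hx' ⊢
    have hmem : φ (σ.right * γ)⁻¹ σ.left * a ∈ cube e (s n) := by
      refine mul_mem_cube e _ (hs n ?_) ha
      exact Finset.mem_image.2 ⟨(σ, γ), Finset.mem_product.2 ⟨hn hσ, hγ⟩, rfl⟩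
    refine mem_productSet.2 ⟨_, ?_, _, hmem, rfl⟩
    refine mem_folnerBoundary.2 ⟨⟨_, Finset.mem_image_of_mem _ hσ, γ, hγ, rfl⟩, fun h => hx' ?_⟩
    exact mem_productSet.2 ⟨_, h, _, hmem, rfl⟩
  have hC : (0 : ℝ) < (cube e (s n)).card := by
    exact_mod_cast Finset.card_pos.2 ⟨1, one_mem_cube e _⟩
  have hle : ((folnerBoundary S (productSet φ (Φ n) (cube e (s n)))).card : ℝ) ≤
      (folnerBoundary (S.image SemidirectProduct.right) (Φ n)).card * (cube e (s n)).card := by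
    exact_mod_cast (Finset.card_le_card hsub).trans (card_productSet _ _).le
  rw [card_productSet, Nat.cast_mul]
  calc _ ≤ ((folnerBoundary (S.image SemidirectProduct.right) (Φ n)).card *
        (cube e (s n)).card : ℝ) / ((Φ n).card * (cube e (s n)).card) := by gcongr
    _ = _ := mul_div_mul_right _ _ hC.ne'

end Amenable

/-! ### Bounds for the kernels of compressions -/

section Bounds

/-- Let n tend to infinity first, with N fixed, and then N: both bounds converge to d because g N
tends to 1. -/
lemma tendsto_of_forall_bounds {K a g : ℕ → ℝ} {t : ℕ → ℕ → ℝ} {d : ℝ}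
    (ha : Tendsto a atTop (𝓝 d)) (hg : Tendsto g atTop (𝓝 1))
    (ht : ∀ N, Tendsto (t N) atTop (𝓝 1)) (hlow : ∀ N n, a N * t N n ≤ K n)
    (hup : ∀ N n, K n ≤ 1 - (g N - a N) * t N n) : Tendsto K atTop (𝓝 d) := by
  rw [tendsto_order]
  constructor
  · intro b hb
    obtain ⟨N, hN⟩ := (ha.eventually (lt_mem_nhds hb)).exists
    have h : Tendsto (fun n => a N * t N n) atTop (𝓝 (a N)) := by
      simpa using (ht N).const_mul (a N)
    filter_upwards [h.eventually (lt_mem_nhds hN)] with n hn using hn.trans_le (hlow N n)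
  · intro b hb
    have h1 : Tendsto (fun N => 1 - (g N - a N)) atTop (𝓝 d) := by
      simpa using (hg.sub ha).const_sub 1
    obtain ⟨N, hN⟩ := (h1.eventually (gt_mem_nhds hb)).exists
    have h : Tendsto (fun n => 1 - (g N - a N) * t N n) atTop (𝓝 (1 - (g N - a N))) := by
      simpa using ((ht N).const_mul (g N - a N)).const_sub 1
    filter_upwards [h.eventually (gt_mem_nhds hN)] with n hn using (hup N n).trans_lt hn

variable {Γ : Type*} [Group Γ] {A : Type*} [CommGroup A] {φ : Γ →* MulAut A}
  [TopologicalSpace A] [DiscreteTopology A]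
  {ι : Type*} (e : Additive A ≃+ (ι →₀ ZMod 2))
  {l : ℕ} {T : Fin l → MonoidAlgebra ZHalf (A ⋊[φ] Γ)} {D : ∀ j, Decomposition φ (T j)}
  (k : Type*) [Field k] (hk : ringChar k ≠ 2)

omit [DiscreteTopology A] in
lemma adjOperator_apply {t : MonoidAlgebra ZHalf (A ⋊[φ] Γ)} (D : Decomposition φ t)
    (G : Finset (MonoidAlgebra ZHalf A)) (v : G →₀ k) (q : G) :
    adjOperator k hk D G v q = ∑ p : G, v p * adjCoeff k hk D p.1 q.1 := by
  classical
  rw [adjOperator, Finsupp.linearCombination_apply, Finsupp.sum_fintype _ _ (by simp)]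
  simp [Finsupp.finsetSum_apply, Finsupp.single_apply]

section Measure

variable [MeasurableSpace (PontryaginDual A)] [BorelSpace (PontryaginDual A)]
  (μ : Measure (PontryaginDual A)) [μ.IsHaarMeasure] [IsProbabilityMeasure μ]

include e in
lemma measureReal_graphSupp {t : MonoidAlgebra ZHalf (A ⋊[φ] Γ)} {D₀ : Decomposition φ t}
    {G : Finset (MonoidAlgebra ZHalf A)} (hG : IsTGraph D₀ G) (L : GraphLabeling D G) :
    μ.real (graphSupp G) = G.card * zhalfReal (L.base.coeff 1) := by
  rw [graphSupp, measureReal_biUnion_finset (fun p hp q hq hpq => hG.orth p hp q hq hpq)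
    fun p hp => (hG.projection p hp).1.measurableSet_hatSupp (mul_self_eq_one e)]
  rw [Finset.sum_congr rfl fun p hp => ?_, Finset.sum_const, nsmul_eq_mul]
  rw [(hG.projection p hp).1.measureReal_hatSupp μ e, ← coeff_actOn_one φ (L.label p) L.base,
    L.actOn_label p hp]

end Measure

omit [DiscreteTopology A] in
lemma GraphLabeling.isProjection_base {t : MonoidAlgebra ZHalf (A ⋊[φ] Γ)}
    {D₀ : Decomposition φ t} {G : Finset (MonoidAlgebra ZHalf A)} (hG : IsTGraph D₀ G)
    (L : GraphLabeling D G) : IsProjection L.base := by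
  rcases L.base_eq with ⟨-, h⟩ | h
  · rw [h]
    intro x
    simp [hatFun]
  · exact (hG.projection _ h).1

-- S depends only on the chosen graphs and not on Φ, which is what the Følner condition requires.
include e in
lemma exists_finrank_ker_bounds [NeZero l] {N : ℕ} {G : Fin N → Finset (MonoidAlgebra ZHalf A)}
    (hG : ∀ i j, IsTGraph (D j) (G i)) (L : ∀ i, GraphLabeling D (G i))
    (horth : ∀ i j, i ≠ j → ∀ p ∈ G i, ∀ q ∈ G j, IsOrth p q) :
    ∃ S : Finset (A ⋊[φ] Γ), ∀ Φ : Finset (A ⋊[φ] Γ), ∃ J : Fin N → ℕ,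
      (∀ i, zhalfReal ((L i).base.coeff 1) * (folnerInterior S Φ).card ≤ J i) ∧
      ∑ i, J i * Module.finrank k (LinearMap.ker (stackedAdjOperator k hk D (G i))) ≤
        Module.finrank k (LinearMap.ker (compression (stackedReduction k hk T) Φ)) ∧
      ∑ i, J i * (G i).card +
          Module.finrank k (LinearMap.ker (compression (stackedReduction k hk T) Φ)) ≤
        Φ.card + ∑ i, J i * Module.finrank k (LinearMap.ker (stackedAdjOperator k hk D (G i))) := by
  classical
  obtain ⟨s, hs⟩ := exists_subset_cube e
    (Finset.univ.biUnion fun i => (L i).base.coeff.support)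
  have hL : ∀ i, (L i).base.coeff.support ⊆ cube e s := fun i =>
    (Finset.subset_biUnion_of_mem (fun i => (L i).base.coeff.support) (Finset.mem_univ i)).trans hs
  -- The block vectors attached to x are supported in Sx, hence in Φ when x is in the interior.
  let S : Finset (A ⋊[φ] Γ) := Finset.univ.biUnion fun i => (G i).biUnion fun p =>
    (cube e s).image fun a => SemidirectProduct.inr ((L i).label p) * SemidirectProduct.inl a
  refine ⟨S, fun Φ => ?_⟩
  obtain ⟨R, hRΨ, hRcard, hR⟩ := exists_representatives
    ((cube e s).image (SemidirectProduct.inl : A →* A ⋊[φ] Γ)) (folnerInterior S Φ)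
    (Finset.mem_image.2 ⟨1, one_mem_cube e s, map_one _⟩)
    (by
      intro x hx y hy
      obtain ⟨a, ha, rfl⟩ := Finset.mem_image.1 hx
      obtain ⟨b, hb, rfl⟩ := Finset.mem_image.1 hy
      exact Finset.mem_image.2 ⟨a * b, mul_mem_cube e s ha hb, map_mul _ _ _⟩)
    (by
      intro x hx
      obtain ⟨a, ha, rfl⟩ := Finset.mem_image.1 hx
      have h : a⁻¹ = a := inv_eq_of_mul_eq_one_left (mul_self_eq_one e a)
      exact Finset.mem_image.2 ⟨a, ha, by rw [← map_inv, h]⟩)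
  rw [Finset.card_image_of_injective _ SemidirectProduct.inl_injective, card_cube] at hRcard
  have hR' : ∀ x ∈ R, ∀ y ∈ R, ∀ a ∈ cube e s,
      (SemidirectProduct.inl a : A ⋊[φ] Γ) * y = x → x = y :=
    fun x hx y hy a ha => hR x hx y hy _ (Finset.mem_image_of_mem _ ha)
  have hmem : ∀ t x, (reductionHom k hk _ (blockVec e s L R t)).coeff x ≠ 0 → x ∈ Φ := by
    intro t x hx
    rw [coeff_reductionHom] at hx
    have hx' : (blockVec e s L R t).coeff x ≠ 0 := fun h => hx (by rw [h, map_zero])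
    obtain ⟨a, ha, rfl⟩ := exists_of_coeff_vertexVec_ne_zero e hx'
    refine (mem_folnerInterior.1 (hRΨ t.2.1.2.2)).2 _ ?_
    exact Finset.mem_biUnion.2 ⟨t.1, Finset.mem_univ _, Finset.mem_biUnion.2
      ⟨t.2.2, t.2.2.2, Finset.mem_image_of_mem _ ha⟩⟩
  have hli := linearIndependent_finProjection (linearIndependent_blockVec e s L R k hk hL
    (by
      intro i i' p hp q hq h
      by_cases hi : i = i'
      · subst hi
        exact (hG i 0).orth p hp q hq (h.resolve_left fun h => h rfl)
      · exact horth i i' hi p hp q hq) hR') hmem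
  -- The domain of the compression consists of columns of length one; the source vectors are the
  -- target vectors seen as such columns.
  have hinj : LinearIndependent k fun t => (fun _ : Fin 1 =>
      finProjection k Φ (reductionHom k hk _ (blockVec e s L R t))) :=
    LinearIndependent.of_comp (LinearMap.proj 0) hli
  have key := finrank_ker_bounds_of_linearIndependent (J := fun i => BlockIndex e s R (L i))
    (fun i j (p q : G i) => adjCoeff k hk (D j) p.1 q.1)
    (fun i => stackedAdjOperator k hk D (G i))
    (fun i v j q => adjOperator_apply k hk (D j) (G i) v q) _ hinj _ hli
    (compression (stackedReduction k hk T) Φ) (by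
      intro i t p j
      rw [compression_apply_const _ (hmem _)]
      have h := reductionHom_mul_vertexVec e k hk (hL i) t.1.2 t.2 p j (hG i j)
      simp only [stackedReduction, Matrix.of_apply]
      change finProjection k Φ (reductionHom k hk _ (T j) *
        reductionHom k hk _ (vertexVec e s (L i) t.1 t.2 p)) = _
      rw [h, map_sum]
      simp only [map_smul]
      rfl)
  refine ⟨fun i => Fintype.card (BlockIndex e s R (L i)), fun i => ?_, key.1, ?_⟩
  · have h1 := congrArg zhalfReal (card_hatFun_eq_one e s ((L i).isProjection_base (hG i 0)) (hL i))
    rw [map_natCast, map_mul, map_pow, map_ofNat] at h1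
    -- Number of idempotents below the base times number of representatives.
    have h2 : (Fintype.card (BlockIndex e s R (L i)) : ℝ) =
        2 ^ s.card * zhalfReal ((L i).base.coeff 1) * R.card := by
      rw [← h1, Fintype.card_prod, Fintype.card_coe, Fintype.card_subtype, Nat.cast_mul]
    have h3 : 0 ≤ zhalfReal ((L i).base.coeff 1) := by
      have : (0 : ℝ) ≤ 2 ^ s.card * zhalfReal ((L i).base.coeff 1) := h1 ▸ Nat.cast_nonneg _
      exact nonneg_of_mul_nonneg_right this (by positivity)
    have h4 : ((folnerInterior S Φ).card : ℝ) ≤ 2 ^ s.card * R.card := by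
      have : Fintype.card (s → ZMod 2) = 2 ^ s.card := by simp [ZMod.card]
      rw [this] at hRcard
      exact_mod_cast hRcard
    rw [h2]
    calc _ ≤ zhalfReal ((L i).base.coeff 1) * (2 ^ s.card * R.card) := by gcongr
      _ = _ := by ring
  · have h := key.2
    simpa [Module.finrank_pi_fintype] using h

end Bounds

/-! ### Passage to the limit along a Følner sequence -/

section Limit

variable {Γ : Type*} [Group Γ] {A : Type*} [CommGroup A] {φ : Γ →* MulAut A}
  [TopologicalSpace A] {l : ℕ} {T : Fin l → MonoidAlgebra ZHalf (A ⋊[φ] Γ)}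
  {D : ∀ j, Decomposition φ (T j)} {G : ℕ → Finset (MonoidAlgebra ZHalf A)}
  (k : Type*) [Field k] (hk : ringChar k ≠ 2)

lemma IsExhausting.hasSum [MeasurableSpace (PontryaginDual A)]
    {μ : Measure (PontryaginDual A)} (h : IsExhausting μ G) :
    HasSum (fun i => μ.real (graphSupp (G i))) 1 := by
  have h1 := ENNReal.hasSum_toReal (f := fun i => μ (graphSupp (G i))) (by rw [h.2]; simp)
  rw [← ENNReal.tsum_toReal_eq fun i => ?_, h.2] at h1
  · exact h1
  · exact ENNReal.ne_top_of_tsum_ne_top (by rw [h.2]; simp) i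

lemma graph_term_nonneg [MeasurableSpace (PontryaginDual A)] (μ : Measure (PontryaginDual A))
    (i : ℕ) : 0 ≤ μ.real (graphSupp (G i)) / ((G i).card : ℝ) *
      (Module.finrank k (LinearMap.ker (stackedAdjOperator k hk D (G i))) : ℝ) := by
  positivity

lemma finrank_ker_stackedAdjOperator_le (G : Finset (MonoidAlgebra ZHalf A)) :
    Module.finrank k (LinearMap.ker (stackedAdjOperator k hk D G)) ≤ G.card := by
  refine (Submodule.finrank_le _).trans ?_
  simp

lemma measureReal_graphSupp_div_mul_card [MeasurableSpace (PontryaginDual A)]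
    (μ : Measure (PontryaginDual A)) (G : Finset (MonoidAlgebra ZHalf A)) :
    μ.real (graphSupp G) / (G.card : ℝ) * G.card = μ.real (graphSupp G) := by
  rcases G.eq_empty_or_nonempty with rfl | h
  · simp [graphSupp]
  · exact div_mul_cancel₀ _ (by exact_mod_cast h.card_pos.ne')

lemma graph_term_le [MeasurableSpace (PontryaginDual A)] (μ : Measure (PontryaginDual A))
    (i : ℕ) : μ.real (graphSupp (G i)) / ((G i).card : ℝ) *
      (Module.finrank k (LinearMap.ker (stackedAdjOperator k hk D (G i))) : ℝ) ≤
      μ.real (graphSupp (G i)) := by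
  conv_rhs => rw [← measureReal_graphSupp_div_mul_card μ (G i)]
  gcongr
  exact finrank_ker_stackedAdjOperator_le k hk (G i)

/-- Convergence of the normalized kernel dimensions for at least one operator. -/
lemma tendsto_finrank_ker_compression [NeZero l] [DiscreteTopology A] {ι : Type*}
    (e : Additive A ≃+ (ι →₀ ZMod 2))
    [MeasurableSpace (PontryaginDual A)] [BorelSpace (PontryaginDual A)]
    (μ : Measure (PontryaginDual A)) [μ.IsHaarMeasure] [IsProbabilityMeasure μ]
    (hG : ∀ i, IsSimplyConnectedGraph D (G i)) (hexh : IsExhausting μ G)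
    (hsum : Summable fun i => μ.real (graphSupp (G i)) / ((G i).card : ℝ) *
      (Module.finrank k (LinearMap.ker (stackedAdjOperator k hk D (G i))) : ℝ))
    {Φ : ℕ → Finset (A ⋊[φ] Γ)} (hΦ : IsFolnerSeq Φ) :
    Tendsto (fun n => (Module.finrank k
        (LinearMap.ker (compression (stackedReduction k hk T) (Φ n))) : ℝ) / ((Φ n).card : ℝ))
      atTop (𝓝 (∑' i, μ.real (graphSupp (G i)) / ((G i).card : ℝ) *
        (Module.finrank k (LinearMap.ker (stackedAdjOperator k hk D (G i))) : ℝ))) := by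
  have hL : ∀ i, Nonempty (GraphLabeling D (G i)) := fun i => (hG i).nonempty_labeling
  let L := fun i => (hL i).some
  have hbounds : ∀ N : ℕ, _ := fun N => exists_finrank_ker_bounds e k hk (N := N)
    (G := fun i => G i) (fun i j => (hG i).isTGraph j) (fun i => L i)
    (fun i j hij => hexh.1 i j fun h => hij (Fin.ext h))
  choose S J hJ hlow hup using hbounds
  -- Equality for nonempty graphs; for an empty graph both sides are 0, by the convention for
  -- division by zero.
  have hm : ∀ i, μ.real (graphSupp (G i)) / ((G i).card : ℝ) ≤ zhalfReal ((L i).base.coeff 1) := by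
    intro i
    rw [measureReal_graphSupp e μ ((hG i).isTGraph 0) (L i)]
    rcases (L i).base_eq with ⟨h, h0⟩ | h
    · rw [h0]; simp
    · have : ((G i).card : ℝ) ≠ 0 := by exact_mod_cast (Finset.card_pos.2 ⟨_, h⟩).ne'
      rw [mul_div_cancel_left₀ _ this]
  have hmJ : ∀ N n (i : Fin N), μ.real (graphSupp (G i)) / ((G i).card : ℝ) *
      (folnerInterior (S N) (Φ n)).card ≤ J N (Φ n) i := fun N n i =>
    (mul_le_mul_of_nonneg_right (hm i) (Nat.cast_nonneg _)).trans (hJ N (Φ n) i)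
  have hpos : ∀ n, (0 : ℝ) < (Φ n).card := fun n => by exact_mod_cast (hΦ.1 n).card_pos
  refine tendsto_of_forall_bounds hsum.hasSum.tendsto_sum_nat hexh.hasSum.tendsto_sum_nat
    (fun N => hΦ.tendsto_card_interior (S N)) (fun N n => ?_) fun N n => ?_
  · have h1 : (∑ i, (J N (Φ n) i : ℝ) *
        Module.finrank k (LinearMap.ker (stackedAdjOperator k hk D (G i)))) ≤
        Module.finrank k (LinearMap.ker (compression (stackedReduction k hk T) (Φ n))) := by
      exact_mod_cast hlow N (Φ n)
    rw [← mul_div_assoc]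
    refine div_le_div_of_nonneg_right (le_trans ?_ h1) (hpos n).le
    rw [← Fin.sum_univ_eq_sum_range (fun i => μ.real (graphSupp (G i)) / ((G i).card : ℝ) *
      (Module.finrank k (LinearMap.ker (stackedAdjOperator k hk D (G i))) : ℝ)), Finset.sum_mul]
    refine Finset.sum_le_sum fun i _ => ?_
    rw [mul_right_comm]
    exact mul_le_mul_of_nonneg_right (hmJ N n i) (Nat.cast_nonneg _)
  · have h1 : (∑ i, (J N (Φ n) i : ℝ) * (G i).card) +
        Module.finrank k (LinearMap.ker (compression (stackedReduction k hk T) (Φ n))) ≤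
        (Φ n).card + ∑ i, (J N (Φ n) i : ℝ) *
          Module.finrank k (LinearMap.ker (stackedAdjOperator k hk D (G i))) := by
      exact_mod_cast hup N (Φ n)
    rw [div_le_iff₀ (hpos n), sub_mul, mul_assoc, div_mul_cancel₀ _ (hpos n).ne', one_mul,
      ← Finset.sum_sub_distrib]
    rw [← Fin.sum_univ_eq_sum_range (fun i => μ.real (graphSupp (G i)) -
      μ.real (graphSupp (G i)) / ((G i).card : ℝ) *
      (Module.finrank k (LinearMap.ker (stackedAdjOperator k hk D (G i))) : ℝ)), Finset.sum_mul]
    have h2 : ∑ i : Fin N, (μ.real (graphSupp (G i)) - μ.real (graphSupp (G i)) /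
        ((G i).card : ℝ) * (Module.finrank k
          (LinearMap.ker (stackedAdjOperator k hk D (G i))) : ℝ)) *
          ((folnerInterior (S N) (Φ n)).card : ℝ) ≤
        ∑ i : Fin N, ((J N (Φ n) i : ℝ) * (G i).card - (J N (Φ n) i : ℝ) *
          Module.finrank k (LinearMap.ker (stackedAdjOperator k hk D (G i)))) := by
      refine Finset.sum_le_sum fun i _ => ?_
      -- Only a lower bound for the number of blocks is known, so the sign of its cofactor matters.
      have h3 : (0 : ℝ) ≤ (G i).card -
          Module.finrank k (LinearMap.ker (stackedAdjOperator k hk D (G i))) :=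
        sub_nonneg.2 (by exact_mod_cast finrank_ker_stackedAdjOperator_le k hk (G i))
      have h4 := mul_le_mul_of_nonneg_right (hmJ N n i) h3
      rw [← mul_sub]
      refine le_trans (le_of_eq ?_) h4
      nth_rewrite 1 [← measureReal_graphSupp_div_mul_card μ (G i)]
      ring
    rw [Finset.sum_sub_distrib (s := Finset.univ) (f := fun i : Fin N =>
      (J N (Φ n) i : ℝ) * (G i).card)] at h2
    linarith

end Limit

theorem mainTheorem1 {k : Type*} [Field k] (hk : ringChar k ≠ 2)
    {Γ : Type*} [Group Γ] [Countable Γ] (hΓ : IsAmenableGroup Γ)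
    {A : Type*} [CommGroup A] [Countable A] [TopologicalSpace A] [DiscreteTopology A]
    {ι : Type*} (hA : Nonempty (Additive A ≃+ (ι →₀ ZMod 2)))
    [MeasurableSpace (PontryaginDual A)] [BorelSpace (PontryaginDual A)]
    (μ : Measure (PontryaginDual A)) [μ.IsHaarMeasure] [IsProbabilityMeasure μ]
    (φ : Γ →* MulAut A)
    {l : ℕ} (T : Fin l → MonoidAlgebra ZHalf (A ⋊[φ] Γ)) (D : ∀ j, Decomposition φ (T j))
    (G : ℕ → Finset (MonoidAlgebra ZHalf A))
    (hG : ∀ i, IsSimplyConnectedGraph D (G i)) (hexh : IsExhausting μ G) :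
    Summable (fun i => μ.real (graphSupp (G i)) / ((G i).card : ℝ) *
        (Module.finrank k (LinearMap.ker (stackedAdjOperator k hk D (G i))) : ℝ)) ∧
      HasKernelGradient (stackedReduction k hk T)
        (∑' i, μ.real (graphSupp (G i)) / ((G i).card : ℝ) *
          (Module.finrank k (LinearMap.ker (stackedAdjOperator k hk D (G i))) : ℝ)) := by
  obtain ⟨e⟩ := hA
  have hsum : Summable fun i => μ.real (graphSupp (G i)) / ((G i).card : ℝ) *
      (Module.finrank k (LinearMap.ker (stackedAdjOperator k hk D (G i))) : ℝ) :=
    Summable.of_nonneg_of_le (graph_term_nonneg k hk μ) (graph_term_le k hk μ) hexh.hasSum.summable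
  refine ⟨hsum, hΓ.semidirectProduct e, fun Φ hΦ => ?_⟩
  rcases Nat.eq_zero_or_pos l with rfl | hl
  -- With no operators the T-graph conditions are void, so the block argument has no projections to
  -- work with. But then all kernels are the full spaces, and both sides equal 1.
  · have h1 : ∀ i, Module.finrank k (LinearMap.ker (stackedAdjOperator k hk D (G i))) =
        (G i).card := fun i => by
      have : LinearMap.ker (stackedAdjOperator k hk D (G i)) = ⊤ :=
        LinearMap.ker_eq_top.2 (Subsingleton.elim _ _)
      rw [this, finrank_top]
      simp
    have h2 : ∀ n, Module.finrank k
        (LinearMap.ker (compression (stackedReduction k hk T) (Φ n))) = (Φ n).card := fun n => by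
      have : LinearMap.ker (compression (stackedReduction k hk T) (Φ n)) = ⊤ :=
        LinearMap.ker_eq_top.2 (Subsingleton.elim _ _)
      rw [this, finrank_top]
      simp [Module.finrank_pi_fintype]
    simp only [h1, h2, measureReal_graphSupp_div_mul_card, hexh.hasSum.tsum_eq]
    refine tendsto_const_nhds.congr fun n => (div_self ?_).symm
    exact_mod_cast (hΦ.1 n).card_pos.ne'
  · have : NeZero l := ⟨hl.ne'⟩
    exact tendsto_finrank_ker_compression k hk e μ hG hexh hsum hΦ
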